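/- **Theorem (Most-discerning implementation with multiple players).** *Setting.* There are $n$ agents. All sets below are Polish spaces with their Borel $\sigma$-algebras. A map is called universally measurable if preimages of Borel sets are measurable for the completion of every Borel probability measure; $k\colon Y\to\Delta(Z)$ denotes a Markov transition, i.e. a map to Borel probability measures such that $y\mapsto k_y(B)$ is universally measurable for every Borel $B\subset Z$. Agent $i$ has a type space $\Theta_i$ and draws his type, independently of the others, from a fixed prior $\mu_i\in\Delta(\Theta_i)$; $\Theta=\prod_i\Theta_i$. For each $i$ there is a set $T_i$ of tests and a Borel passage rate $\pi_i\colon T_i\times\Theta_i\to[0,1]$; $T=\prod_i T_i$. *Discernment.* Let $\pi_{\tau_i|\theta_i}$ be the measure on $\{0,1\}$ with mass $\pi_i(\tau_i|\theta_i)$ at $1$. For $\tau_i,\psi_i\in T_i$ write $\tau_i\succeq_{\theta_i}\psi_i$ if there is a Markov transition $k$ on $\{0,1\}$ with $k_1\ge_{\mathrm{SD}}k_0$ (first-order stochastic dominance), $\pi_{\tau_i|\theta_i}k=\pi_{\psi_i|\theta_i}$, and $\pi_{\tau_i|\theta_i'}k\le_{\mathrm{SD}}\pi_{\psi_i|\theta_i'}$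 for all $\theta_i'\ne\theta_i$. A function $\hat t_i\colon\Theta_i\to T_i$ is *most discerning* if $\hat t_i(\theta_i)\succeq_{\theta_i}\psi_i$ for all $\theta_i\in\Theta_i$ and $\psi_i\in T_i$. *Implementation.* A decision environment $(X,u)$ is a decision set $X$ with Borel utility functions $u_i\colon X\times\Theta\to\mathbf R$, $i=1,\dots,n$. A mechanism consists of message spaces $M_i$ (with $M=\prod_i M_i$), a testing rule $t\colon M\to\Delta(T)$ and a decision rule $g\colon M\times T\times\{0,1\}^n\to\Delta(X)$. A strategy of agent $i$ consists of $r_i\colon\Theta_i\to\Delta(M_i)$ and a universally measurable $e_i\colon\Theta_i\times M_i\times T_i\to[0,1]$. Messages are drawn independently, $m_i\sim r_i(\theta_i)$; then $\tau\sim t(m)$; then, independently across agents, agent $i$ gets score $1$ with probability $e_i(\theta_i,m_i,\tau_i)\,\pi_i(\tau_i|\theta_i)$ and score $0$ otherwise; then the decision is drawn from $g(m,\tau,s)$. A strategy profile is a Bayes–Nash equilibrium if, for every $i$ and every type $\theta_i\in\Theta_i$, the interim expected utility of type $\theta_i$ (with the other agents' types drawn from their priors) is well defined and finite, and no strategy of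 agent $i$ gives type $\theta_i$ a strictly higher one (a deviation for which both the positive and the negative part of the utility have infinite expectation does not count as profitable). A mechanism and a strategy profile implement a social choice function $f\colon\Theta\to\Delta(X)$ if the strategy profile is a Bayes–Nash equilibrium and the decision has law $f(\theta)$ for every type profile $\theta\in\Theta$; $f$ is implementable if some mechanism and strategy profile implement it. It is *canonically implementable with* $\hat t\colon\Theta\to T$ if this is possible with $M_i=\Theta_i$, the testing rule $\theta\mapsto\delta_{\hat t(\theta)}$, truthful reports $r_i(\theta_i)=\delta_{\theta_i}$, and effort $e_i(\theta_i,\theta_i,\tau_i)=1$ for all $i,\theta_i,\tau_i$. *Statement.* Let $\hat t_i\colon\Theta_i\to T_i$ be universally measurable for $i=1,\dots,n$, and let $\hat t=\otimes_i\hat t_i$, i.e. $\hat t(\theta)=(\hat t_1(\theta_1),\dots,\hat t_n(\theta_n))$. The following are equivalent. 1. $\hat t_i$ is most discerning for all $i$. 2. In every decision environment $(X,u)$, every implementable social choice function is canonically implementable with $\hat t$. -/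

import Mathlib

open MeasureTheory ProbabilityTheory
open scoped ENNReal unitInterval ProbabilityTheory

universe a b c d

namespace TestDesign

/-- The universal completion of the σ-algebra of `X`: the intersection, over all probability
measures `μ` on `X`, of the `μ`-completions (null-measurable sets). -/
@[reducible]
def universalCompletion (X : Type*) [MeasurableSpace X] : MeasurableSpace X where
  MeasurableSet' s := ∀ μ : Measure X, IsProbabilityMeasure μ → NullMeasurableSet s μ
  measurableSet_empty _ _ := nullMeasurableSet_empty
  measurableSet_compl _ hs μ hμ := (hs μ hμ).compl
  measurableSet_iUnion _ hs μ hμ := NullMeasurableSet.iUnion fun k => hs k μ hμ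

/-- Markov transitions `X → Δ(Y)`, universally measurable in the source point. (A Borel
probability measure extends uniquely to the universal completion, so that the target may carry its
Borel σ-algebra.) -/
abbrev Transition (X Y : Type*) [MeasurableSpace X] [MeasurableSpace Y] :=
  {κ : Kernel[universalCompletion X] X Y // @IsMarkovKernel X Y (universalCompletion X) _ κ}

/-! ### Scores and the discernment orders

A score is an element of `Bool`: `true` is a pass (score 1), `false` is a fail (score 0). -/

/-- The distribution of the score that puts probability `p` on a pass. -/
noncomputable def scoreLaw (p : I) : PMF Bool :=
  PMF.ofFintype (fun s => ((if s then unitInterval.toNNReal p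
      else unitInterval.toNNReal (unitInterval.symm p) : NNReal) : ℝ≥0∞)) (by
    rw [Fintype.sum_bool, if_pos rfl, if_neg Bool.false_ne_true, ← ENNReal.coe_add,
      unitInterval.toNNReal_add_toNNReal_symm, ENNReal.coe_one])

/-- First-order stochastic dominance `p ≥ q` between score distributions: the cumulative
distribution function of `p` lies pointwise below that of `q`. -/
def StochDominates (p q : PMF Bool) : Prop :=
  ∀ s : Bool, ∑ r : Bool with r ≤ s, p r ≤ ∑ r : Bool with r ≤ s, q r

/-- A score conversion (a Markov transition on the two scores) is monotone. -/
def MonotoneConversion (k : Bool → PMF Bool) : Prop :=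
  StochDominates (k true) (k false)

section SingleAgent

variable {Θ T : Type*}

/-- Given the passage rate `π`, the test `τ` is more `θ`-discerning than the test `ψ`. -/
def MoreDiscerning (π : T × Θ → I) (θ : Θ) (τ ψ : T) : Prop :=
  ∃ k : Bool → PMF Bool, MonotoneConversion k ∧
    (scoreLaw (π (τ, θ))).bind k = scoreLaw (π (ψ, θ)) ∧
    ∀ θ', θ' ≠ θ → StochDominates (scoreLaw (π (ψ, θ'))) ((scoreLaw (π (τ, θ'))).bind k)

/-- A testing function is most discerning: for each type `θ`, the test `t θ` is more
`θ`-discerning than every test. -/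
def MostDiscerning (π : T × Θ → I) (t : Θ → T) : Prop :=
  ∀ θ ψ, MoreDiscerning π θ (t θ) ψ

end SingleAgent

/-! ### Mechanisms and strategies for `n` agents -/

/-- A mechanism with message spaces `M i`, test sets `T i` and decision set `X`. -/
structure Mechanism {n : ℕ} (M T : Fin n → Type*) (X : Type*) [∀ i, MeasurableSpace (M i)]
    [∀ i, MeasurableSpace (T i)] [MeasurableSpace X] where
  /-- the testing rule -/
  test : Transition (∀ i, M i) (∀ i, T i)
  /-- the decision rule: it maps messages, tests and scores to a decision lottery -/
  decision : Transition ((∀ i, M i) × (∀ i, T i) × (Fin n → Bool)) X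

/-- A strategy of one agent with type space `Θ`, message space `M` and test set `T`. -/
structure Strategy (Θ M T : Type*) [MeasurableSpace Θ] [MeasurableSpace M]
    [MeasurableSpace T] where
  /-- the reporting strategy -/
  report : Transition Θ M
  /-- the effort strategy: the probability of exerting effort -/
  effort : Θ × M × T → I
  measurable_effort : Measurable[universalCompletion (Θ × M × T)] effort

section Game

variable {n : ℕ} {Θ M T : Fin n → Type*} {X : Type*} [∀ i, MeasurableSpace (Θ i)]
  [∀ i, MeasurableSpace (M i)] [∀ i, MeasurableSpace (T i)] [MeasurableSpace X]

/-- The expectation of `φ` of the decision when the type profile is `θ`. Messages are drawn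
independently from the reporting strategies, then the tests from the testing rule; then agent `i`,
who sees only his own type, message and test, passes with probability effort times passage rate,
independently across agents; then the decision is drawn from the decision rule. -/
noncomputable def outcomeExp (π : ∀ i, T i × Θ i → I) (mech : Mechanism M T X)
    (str : ∀ i, Strategy (Θ i) (M i) (T i)) (θ : ∀ i, Θ i) (φ : X → ℝ≥0∞) : ℝ≥0∞ :=
  ∫⁻ m, ∫⁻ τ, ∑ s : Fin n → Bool,
      (∏ i, scoreLaw ((str i).effort (θ i, m i, τ i) * π i (τ i, θ i)) (s i)) *
        ∫⁻ x, φ x ∂(mech.decision.1 (m, τ, s))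
    ∂(mech.test.1 m) ∂(Measure.pi fun i => (str i).report.1 (θ i))

/-- The profile induces the social choice function `f`. -/
def Induces (π : ∀ i, T i × Θ i → I) (mech : Mechanism M T X)
    (str : ∀ i, Strategy (Θ i) (M i) (T i)) (f : Transition (∀ i, Θ i) X) : Prop :=
  ∀ θ, ∀ B : Set X, MeasurableSet B →
    f.1 θ B = outcomeExp π mech str θ (B.indicator fun _ => 1)

/-- The expectation of `φ` of decision and type profile, conditional on agent `i` having type
`t`; the types of the other agents are drawn independently from the priors `μ j`. -/
noncomputable def interimExp (μ : ∀ i, Measure (Θ i)) (π : ∀ i, T i × Θ i → I)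
    (mech : Mechanism M T X) (str : ∀ i, Strategy (Θ i) (M i) (T i)) (i : Fin n) (t : Θ i)
    (φ : X × (∀ i, Θ i) → ℝ≥0∞) : ℝ≥0∞ :=
  ∫⁻ θ, outcomeExp π mech str (Function.update θ i t) (fun x => φ (x, Function.update θ i t))
    ∂(Measure.pi μ)

/-- Interim expectation of the positive part of the utility function `v`. -/
noncomputable def interimGain (μ : ∀ i, Measure (Θ i)) (π : ∀ i, T i × Θ i → I)
    (mech : Mechanism M T X) (str : ∀ i, Strategy (Θ i) (M i) (T i)) (i : Fin n) (t : Θ i)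
    (v : X × (∀ i, Θ i) → ℝ) : ℝ≥0∞ :=
  interimExp μ π mech str i t fun z => ENNReal.ofReal (v z)

/-- Interim expectation of the negative part of the utility function `v`. -/
noncomputable def interimLoss (μ : ∀ i, Measure (Θ i)) (π : ∀ i, T i × Θ i → I)
    (mech : Mechanism M T X) (str : ∀ i, Strategy (Θ i) (M i) (T i)) (i : Fin n) (t : Θ i)
    (v : X × (∀ i, Θ i) → ℝ) : ℝ≥0∞ :=
  interimExp μ π mech str i t fun z => ENNReal.ofReal (-v z)

/-- Interim expected utility, an extended real number; it is the expected utility whenever the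
latter is well defined in `[-∞, ∞)` or `(-∞, ∞]`, and `-∞` if gain and loss are both infinite. -/
noncomputable def interimUtility (μ : ∀ i, Measure (Θ i)) (π : ∀ i, T i × Θ i → I)
    (mech : Mechanism M T X) (str : ∀ i, Strategy (Θ i) (M i) (T i)) (i : Fin n) (t : Θ i)
    (v : X × (∀ i, Θ i) → ℝ) : EReal :=
  (interimGain μ π mech str i t v : EReal) - (interimLoss μ π mech str i t v : EReal)

/-- Bayes–Nash equilibrium: every type of every agent has a finite expected utility, and no
strategy of this agent gives that type a higher one, when the other agents keep to theirs. -/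
def IsBayesNash (μ : ∀ i, Measure (Θ i)) (π : ∀ i, T i × Θ i → I)
    (u : Fin n → X × (∀ i, Θ i) → ℝ) (mech : Mechanism M T X)
    (str : ∀ i, Strategy (Θ i) (M i) (T i)) : Prop :=
  ∀ (i : Fin n) (t : Θ i),
    interimGain μ π mech str i t (u i) ≠ ∞ ∧ interimLoss μ π mech str i t (u i) ≠ ∞ ∧
    ∀ str' : Strategy (Θ i) (M i) (T i),
      interimUtility μ π mech (Function.update str i str') i t (u i) ≤
        interimUtility μ π mech str i t (u i)

/-- The profile implements the social choice function `f`. -/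
def Implements (μ : ∀ i, Measure (Θ i)) (π : ∀ i, T i × Θ i → I)
    (u : Fin n → X × (∀ i, Θ i) → ℝ) (mech : Mechanism M T X)
    (str : ∀ i, Strategy (Θ i) (M i) (T i)) (f : Transition (∀ i, Θ i) X) : Prop :=
  IsBayesNash μ π u mech str ∧ Induces π mech str f

/-- Strategies of a canonical profile: in a direct mechanism, every agent reports truthfully and
exerts effort on every test. -/
def IsCanonical (str : ∀ i, Strategy (Θ i) (Θ i) (T i)) : Prop :=
  ∀ i, (∀ t, (str i).report.1 t = Measure.dirac t) ∧ ∀ t τ, (str i).effort (t, t, τ) = 1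

/-- `f` is canonically implementable with the testing function `tHat`. -/
def CanonicallyImplementableWith (μ : ∀ i, Measure (Θ i)) (π : ∀ i, T i × Θ i → I)
    (u : Fin n → X × (∀ i, Θ i) → ℝ) (tHat : (∀ i, Θ i) → ∀ i, T i)
    (f : Transition (∀ i, Θ i) X) : Prop :=
  ∃ (mech : Mechanism Θ T X) (str : ∀ i, Strategy (Θ i) (Θ i) (T i)),
    (∀ θ, mech.test.1 θ = Measure.dirac (tHat θ)) ∧ IsCanonical str ∧
      Implements μ π u mech str f

end Game

/-- `f` is implementable: some mechanism, with Polish message spaces, and some strategy profile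
implement it. -/
def Implementable {n : ℕ} {Θ : Fin n → Type a} {T : Fin n → Type b} {X : Type c}
    [∀ i, MeasurableSpace (Θ i)] [∀ i, MeasurableSpace (T i)] [MeasurableSpace X]
    (μ : ∀ i, Measure (Θ i)) (π : ∀ i, T i × Θ i → I)
    (u : Fin n → X × (∀ i, Θ i) → ℝ) (f : Transition (∀ i, Θ i) X) : Prop :=
  ∃ (M : Fin n → Type d) (_ : ∀ i, TopologicalSpace (M i)) (_ : ∀ i, PolishSpace (M i))
    (_ : ∀ i, MeasurableSpace (M i)) (_ : ∀ i, BorelSpace (M i))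
    (mech : Mechanism M T X) (str : ∀ i, Strategy (Θ i) (M i) (T i)),
    Implements μ π u mech str f

end TestDesign

namespace TestDesign

/-! ### Universal measurability -/

section UniversalMeasurability

open MeasurableSpace

variable {X Y Z : Type*} [MeasurableSpace X] [MeasurableSpace Y] [MeasurableSpace Z]

/-! Most discerning tests suffice by a revelation argument with score conversion. Given a mechanism
and an equilibrium, the direct mechanism asks for types, gives the tests `tHat`, privately draws the
messages that the reported types would send and the tests the mechanism would then choose, and turns
each actual score into a simulated score on the drawn test. The conversion fixes the pass
probability of the reported type and raises that of no other type above its own rate on the drawn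
test. So truthful play reproduces the original outcome (`outcomeExp_truthful`). A type that
misreports passes a simulated test with a probability it could have reached in the original
mechanism by reduced effort (`imitate_effort_mul`). A deviation is thus a mixture of deviations from
the original equilibrium (`interimExp_update_truthful`), and a mixture of unprofitable deviations is
unprofitable (`lintegral_sub_lintegral_le`).

The analytic difficulty is to choose the conversions measurably, since discernment only asserts
their existence. A conversion that fixes the rate of one type is determined by its slope, and the
least admissible slope is a supremum of a Borel function over all types (`conversion_spec`). Its
superlevel sets are projections of Borel sets, hence analytic, hence universally measurable
(`universal_conversion`).

Conversely, let agent `i` win a prize exactly when he passes `ψ`. This is implementable. In a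
canonical implementation, the interim win probabilities after reporting `t` and then failing or
passing do not depend on the true type, so they form a conversion of `tHat i t` into `ψ`. Truthful
play of `t` gives the required equality, and incentive compatibility of the other types gives the
inequalities (`moreDiscerning_of_canonicallyImplementableWith`). -/

theorem le_universalCompletion : ‹MeasurableSpace X› ≤ universalCompletion X :=
  fun _ hs _ _ => hs.nullMeasurableSet

theorem measurable_universalCompletion {f : X → Y} (hf : Measurable f) :
    Measurable[universalCompletion X] f :=
  hf.mono le_universalCompletion le_rfl

theorem aemeasurable_of_universal [CountablyGenerated Y] {f : X → Y}
    (hf : Measurable[universalCompletion X] f) (ν : Measure X) [IsProbabilityMeasure ν] :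
    AEMeasurable f ν :=
  NullMeasurable.aemeasurable fun _ hs => hf hs ν ‹_›

theorem universal_of_aemeasurable {f : X → Y}
    (hf : ∀ (ν : Measure X) [IsProbabilityMeasure ν], AEMeasurable f ν) :
    Measurable[universalCompletion X] f :=
  fun _ hs ν _ => (hf ν).nullMeasurable hs

/-- A universally measurable map pulls back universally measurable sets to such sets. -/
theorem measurable_universal_universal [CountablyGenerated Y] {f : X → Y}
    (hf : Measurable[universalCompletion X] f) :
    Measurable[universalCompletion X, universalCompletion Y] f := by
  intro s hs ν _
  have hfν := aemeasurable_of_universal hf ν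
  have : IsProbabilityMeasure (ν.map f) := Measure.isProbabilityMeasure_map hfν
  have h1 : NullMeasurableSet s (ν.map f) := hs _ this
  obtain ⟨t, ht, hst⟩ := h1
  refine ⟨hfν.mk f ⁻¹' t, hfν.measurable_mk ht, ?_⟩
  have h2 : ∀ᵐ x ∂ν, s (f x) = t (f x) := ae_of_ae_map hfν hst
  filter_upwards [h2, hfν.ae_eq_mk] with x hx hx'
  change s (f x) = t (hfν.mk f x)
  rw [hx, ← hx']

theorem universal_comp [CountablyGenerated Y] {f : X → Y} {g : Y → Z}
    (hg : Measurable[universalCompletion Y] g) (hf : Measurable[universalCompletion X] f) :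
    Measurable[universalCompletion X] fun x => g (f x) :=
  Measurable.comp hg (measurable_universal_universal hf)

/-- A universally measurable family of probability measures agrees almost everywhere with a
measurable one. -/
theorem aemeasurable_measure_of_universal [CountablyGenerated Y] {κ : X → Measure Y}
    [∀ x, IsProbabilityMeasure (κ x)] (hκ : Measurable[universalCompletion X] κ)
    (ν : Measure X) [IsProbabilityMeasure ν] : AEMeasurable κ ν := by
  classical
  obtain ⟨x₀⟩ : Nonempty X := ν.nonempty_of_neZero
  have hcoe : ∀ B, MeasurableSet B → AEMeasurable (fun x => κ x B) ν := fun B hB =>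
    aemeasurable_of_universal ((Measure.measurable_coe hB).comp hκ) ν
  -- Evaluation at each set of a countable generating algebra is modified separately. Countability
  -- gives one null set off which all modifications agree with `κ`, and an algebra is a π-system, so
  -- these evaluations decide measurability.
  set C := generateSetAlgebra (countableGeneratingSet Y)
  have hC : C.Countable := countable_generateSetAlgebra countable_countableGeneratingSet
  have hgen : ‹MeasurableSpace Y› = generateFrom C := by
    rw [generateFrom_generateSetAlgebra_eq, generateFrom_countableGeneratingSet]
  have hCm : ∀ B ∈ C, MeasurableSet B := fun B hB => by
    rw [hgen]; exact measurableSet_generateFrom hB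
  have hae : ∀ᵐ x ∂ν, ∀ B (hB : B ∈ C), κ x B = (hcoe B (hCm B hB)).mk _ x :=
    (ae_ball_iff hC).2 fun B hB => (hcoe B (hCm B hB)).ae_eq_mk
  obtain ⟨N, hN, hNm, hN0⟩ := exists_measurable_superset_of_null (ae_iff.1 hae)
  have hκN : ∀ x ∉ N, ∀ B (hB : B ∈ C), κ x B = (hcoe B (hCm B hB)).mk _ x := fun x hx => by
    by_contra h; exact hx (hN h)
  -- On the exceptional set the fixed value `κ x₀` keeps the family one of probability measures, as
  -- the π-system criterion needs.
  refine ⟨fun x => if x ∈ N then κ x₀ else κ x, ?_, ?_⟩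
  · have : ∀ x, IsProbabilityMeasure (if x ∈ N then κ x₀ else κ x) := fun x => by
      split_ifs <;> infer_instance
    refine Measurable.measure_of_isPiSystem_of_isProbabilityMeasure hgen
      (fun s hs t ht _ => isSetAlgebra_generateSetAlgebra.inter_mem hs ht) fun B hB => ?_
    have : (fun x => (if x ∈ N then κ x₀ else κ x) B) =
        fun x => if x ∈ N then κ x₀ B else (hcoe B (hCm B hB)).mk _ x := by
      ext x
      split_ifs with hx
      · rfl
      · exact hκN x hx B hB
    rw [this]
    exact Measurable.ite hNm measurable_const (hcoe B (hCm B hB)).measurable_mk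
  · have : ∀ᵐ x ∂ν, x ∉ N := measure_eq_zero_iff_ae_notMem.1 hN0
    filter_upwards [this] with x hx
    rw [if_neg hx]

/-- Integrals of universally measurable functions against universally measurable families. -/
theorem universal_lintegral [CountablyGenerated X] [CountablyGenerated Y] {κ : X → Measure Y}
    [∀ x, IsProbabilityMeasure (κ x)] (hκ : Measurable[universalCompletion X] κ)
    {f : X × Y → ℝ≥0∞} (hf : Measurable[universalCompletion (X × Y)] f) :
    Measurable[universalCompletion X] fun x => ∫⁻ y, f (x, y) ∂κ x := by
  -- Lifting `κ x` to the product makes the integrand independent of `x`. It is then almost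
  -- everywhere measurable for the single mixture of the lifted measures under `ν`.
  have hP : Measurable[universalCompletion X] fun x => (κ x).map fun y => (x, y) := by
    have : ∀ x, IsProbabilityMeasure ((κ x).map fun y => (x, y)) := fun x =>
      Measure.isProbabilityMeasure_map (by fun_prop)
    refine Measurable.measure_of_isPiSystem_of_isProbabilityMeasure generateFrom_prod.symm
      isPiSystem_prod ?_
    rintro _ ⟨s, hs, t, ht, rfl⟩
    have h : (fun x => (κ x).map (fun y => (x, y)) (s ×ˢ t)) =
        fun x => s.indicator (fun x => κ x t) x := by
      ext x
      rw [Measure.map_apply (by fun_prop) (hs.prod ht)]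
      by_cases hx : x ∈ s <;> 
        simp [hx, Set.mk_preimage_prod_right, Set.mk_preimage_prod_right_eq_empty]
    rw [h]
    exact ((Measure.measurable_coe ht).comp hκ).indicator (le_universalCompletion _ hs)
  have : ∀ x, IsProbabilityMeasure ((κ x).map fun y => (x, y)) := fun x =>
    Measure.isProbabilityMeasure_map (by fun_prop)
  refine universal_of_aemeasurable fun ν _ => ?_
  have hPν := aemeasurable_measure_of_universal hP ν
  have hjoin : IsProbabilityMeasure (ν.bind fun x => (κ x).map fun y => (x, y)) := ⟨by
    rw [Measure.bind_apply .univ hPν]; simp⟩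
  have h := (Measure.aemeasurable_lintegral (m := ν.map fun x => (κ x).map fun y => (x, y))
    (f := f) (@aemeasurable_of_universal _ _ _ _ _ _ hf _ hjoin)).comp_aemeasurable hPν
  refine h.congr (.of_forall fun x => ?_)
  exact lintegral_map' (aemeasurable_of_universal hf _) (by fun_prop)

/-- Capacitability of analytic sets. Coordinates of the parameter are bounded one at a time, each
bound so large that the image still has measure above `c`. All bounds together cut out a compact
box. An open set around the image of the box already contains the image of the sequences that obey
finitely many of the bounds, so it has measure above `c`, and outer regularity concludes. -/
theorem exists_compact_measure_ge_of_range [TopologicalSpace X] [PolishSpace X] [BorelSpace X]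
    (ν : Measure X) [IsProbabilityMeasure ν] {f : (ℕ → ℕ) → X} (hf : Continuous f) {c : ℝ≥0∞}
    (hc : c < ν (Set.range f)) : ∃ K ⊆ Set.range f, IsCompact K ∧ c ≤ ν K := by
  classical
  have hstep : ∀ S : Set (ℕ → ℕ), c < ν (f '' S) → ∀ k, ∃ m, c < ν (f '' {x ∈ S | x k ≤ m}) := by
    intro S hS k
    have hU : f '' S = ⋃ m, f '' {x ∈ S | x k ≤ m} := by
      ext y
      simp only [Set.mem_image, Set.mem_iUnion]
      exact ⟨fun ⟨x, hx, h⟩ => ⟨x k, x, ⟨hx, le_rfl⟩, h⟩, fun ⟨_, x, hx, h⟩ => ⟨x, hx.1, h⟩⟩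
    have hmono : Monotone fun m => f '' {x ∈ S | x k ≤ m} := fun m m' h =>
      Set.image_mono fun x hx => ⟨hx.1, hx.2.trans h⟩
    rw [hU, hmono.measure_iUnion] at hS
    exact lt_iSup_iff.1 hS
  choose! m hm using hstep
  let F : ℕ → Set (ℕ → ℕ) := fun k => k.rec Set.univ fun k S => {x ∈ S | x k ≤ m S k}
  have hF : ∀ k, c < ν (f '' F k) := by
    intro k
    induction k with
    | zero => simpa [F] using hc
    | succ k ih => exact hm _ ih k
  set s : ℕ → ℕ := fun k => m (F k) k
  have hFs : ∀ k x, x ∈ F k ↔ ∀ i < k, x i ≤ s i := by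
    intro k x
    induction k with
    | zero => simp [F]
    | succ k ih =>
      change (x ∈ F k ∧ x k ≤ s k) ↔ _
      rw [ih]
      simp only [Nat.lt_succ_iff_lt_or_eq]
      exact ⟨fun h i hi => hi.elim (h.1 i) (fun e => e ▸ h.2),
        fun h => ⟨fun i hi => h i (.inl hi), h k (.inr rfl)⟩⟩
  set C : Set (ℕ → ℕ) := Set.univ.pi fun i => Set.Iic (s i)
  have hC : IsCompact C := isCompact_univ_pi fun i => (Set.finite_Iic _).isCompact
  refine ⟨f '' C, Set.image_subset_range _ _, hC.image hf, ?_⟩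
  rw [(f '' C).measure_eq_iInf_isOpen ν]
  refine le_iInf₂ fun U hU => le_iInf fun hUo => ?_
  have hcyl : ∀ x ∈ C, ∃ n, PiNat.cylinder x n ⊆ f ⁻¹' U := fun x hx => by
    obtain ⟨_, ⟨z, n, rfl⟩, hxz, hzU⟩ :=
      (PiNat.isTopologicalBasis_cylinders fun _ : ℕ => ℕ).exists_subset_of_mem_open
        (hU (Set.mem_image_of_mem f hx)) (hUo.preimage hf)
    exact ⟨n, (PiNat.mem_cylinder_iff_eq.1 hxz).trans_subset hzU⟩
  choose! N hN using hcyl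
  obtain ⟨t, htC, ht⟩ := hC.elim_nhds_subcover (fun x => PiNat.cylinder x (N x)) fun x _ =>
    (PiNat.isOpen_cylinder _ x _).mem_nhds (PiNat.self_mem_cylinder x _)
  refine (hF (t.sup N)).le.trans (measure_mono ?_)
  rintro _ ⟨y, hy, rfl⟩
  rw [hFs] at hy
  -- Truncation moves `y` into the box without changing the first `t.sup N` coordinates, which alone
  -- decide membership in the covering cylinders.
  have hy' : (fun i => min (y i) (s i)) ∈ C := fun i _ => Set.mem_Iic.2 (min_le_right _ _)
  obtain ⟨x, hx, hxy⟩ := Set.mem_iUnion₂.1 (ht hy')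
  refine hN x (htC x hx) fun i hi => ?_
  rw [← hxy i hi]
  exact (min_eq_left (hy i (hi.trans_le (Finset.le_sup hx)))).symm

/-- Analytic sets are universally measurable. -/
theorem _root_.MeasureTheory.AnalyticSet.measurableSet_universalCompletion [TopologicalSpace X]
    [PolishSpace X] [BorelSpace X] {s : Set X} (hs : AnalyticSet s) :
    MeasurableSet[universalCompletion X] s := by
  intro ν _
  rw [AnalyticSet] at hs
  rcases hs with rfl | ⟨f, hf, rfl⟩
  · exact nullMeasurableSet_empty
  by_cases h0 : ν (Set.range f) = 0
  · exact .of_null h0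
  obtain ⟨c, -, hc, hlim⟩ := exists_seq_strictMono_tendsto' (pos_iff_ne_zero.2 h0)
  choose K hKsub hK hKc using fun n => exists_compact_measure_ge_of_range ν hf (hc n).2
  have hm : MeasurableSet (⋃ n, K n) := .iUnion fun n => (hK n).measurableSet
  refine hm.nullMeasurableSet.congr (ae_eq_of_subset_of_measure_ge (Set.iUnion_subset hKsub) ?_
    hm.nullMeasurableSet (measure_ne_top _ _))
  exact le_of_tendsto' hlim fun n => (hKc n).trans (measure_mono (Set.subset_iUnion K n))

/-- The supremum over a parameter in a standard Borel space of a jointly measurable function is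
universally measurable. -/
theorem universal_iSup [StandardBorelSpace X] [StandardBorelSpace Y]
    {g : X × Y → I} (hg : Measurable g) :
    Measurable[universalCompletion X] fun x => ⨆ y, g (x, y) := by
  let := upgradeStandardBorel X
  refine measurable_of_Ioi fun c => ?_
  have : (fun x => ⨆ y, g (x, y)) ⁻¹' Set.Ioi c = Prod.fst '' (g ⁻¹' Set.Ioi c) := by
    ext x
    simp [lt_iSup_iff]
  rw [this]
  exact ((hg measurableSet_Ioi).analyticSet_image measurable_fst).measurableSet_universalCompletion

theorem universal_of_countable_cases {ι : Type*} [Countable ι] [MeasurableSpace ι]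
    [MeasurableSingletonClass ι] {e : X → ι} (he : Measurable e) {f : ι → X → Y}
    (hf : ∀ i, Measurable[universalCompletion X] (f i)) :
    Measurable[universalCompletion X] fun x => f (e x) x := by
  intro A hA
  have : (fun x => f (e x) x) ⁻¹' A = ⋃ i, e ⁻¹' {i} ∩ f i ⁻¹' A := by
    ext x; simp
  rw [this]
  exact MeasurableSet.iUnion fun i =>
    (le_universalCompletion _ (he (measurableSet_singleton i))).inter (hf i hA)

/-! ### Markov transitions: composition, mixtures and products. -/

instance (κ : Transition X Y) (x : X) : IsProbabilityMeasure (κ.1 x) :=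
  κ.2.isProbabilityMeasure x

theorem Transition.universal (κ : Transition X Y) :
    Measurable[universalCompletion X] fun x => κ.1 x :=
  κ.1.measurable

/-- The transition given by a universally measurable family of probability measures. -/
def Transition.mk (κ : X → Measure Y) (hκ : Measurable[universalCompletion X] κ)
    (hp : ∀ x, IsProbabilityMeasure (κ x)) : Transition X Y :=
  ⟨@Kernel.mk X Y (universalCompletion X) _ κ hκ,
    @IsMarkovKernel.mk X Y (universalCompletion X) _ _ hp⟩

@[simp]
theorem Transition.mk_apply (κ : X → Measure Y) (hκ : Measurable[universalCompletion X] κ)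
    (hp : ∀ x, IsProbabilityMeasure (κ x)) (x : X) : (Transition.mk κ hκ hp).1 x = κ x := rfl

theorem lintegral_bind_universal [CountablyGenerated Y] {ν : Measure X} [IsProbabilityMeasure ν]
    {η : X → Measure Y} [∀ x, IsProbabilityMeasure (η x)]
    (hη : Measurable[universalCompletion X] η) {φ : Y → ℝ≥0∞} (hφ : Measurable φ) :
    ∫⁻ y, φ y ∂ν.bind η = ∫⁻ x, ∫⁻ y, φ y ∂η x ∂ν :=
  Measure.lintegral_bind (aemeasurable_measure_of_universal hη ν) hφ.aemeasurable

theorem isProbabilityMeasure_bind_universal [CountablyGenerated Y] {ν : Measure X}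
    [IsProbabilityMeasure ν] {η : X → Measure Y} [∀ x, IsProbabilityMeasure (η x)]
    (hη : Measurable[universalCompletion X] η) : IsProbabilityMeasure (ν.bind η) := ⟨by
  rw [Measure.bind_apply .univ (aemeasurable_measure_of_universal hη ν)]; simp⟩

theorem universal_section {f : X × Y → Z} (hf : Measurable[universalCompletion (X × Y)] f)
    [CountablyGenerated X] [CountablyGenerated Y] (x : X) :
    Measurable[universalCompletion Y] fun y => f (x, y) :=
  universal_comp hf (measurable_universalCompletion measurable_prodMk_left)

theorem universal_bind [CountablyGenerated X] [CountablyGenerated Y] [CountablyGenerated Z]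
    {κ : X → Measure Y} [∀ x, IsProbabilityMeasure (κ x)]
    (hκ : Measurable[universalCompletion X] κ) {η : X × Y → Measure Z}
    [∀ z, IsProbabilityMeasure (η z)] (hη : Measurable[universalCompletion (X × Y)] η) :
    Measurable[universalCompletion X] fun x => (κ x).bind fun y => η (x, y) := by
  refine Measure.measurable_of_measurable_coe _ fun B hB => ?_
  have : (fun x => ((κ x).bind fun y => η (x, y)) B) = fun x => ∫⁻ y, η (x, y) B ∂κ x := by
    ext x
    exact Measure.bind_apply hB (aemeasurable_measure_of_universal (universal_section hη x) _)
  rw [this]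
  exact universal_lintegral hκ ((Measure.measurable_coe hB).comp hη)

theorem universal_sum_smul {ι : Type*} [Fintype ι] {w : ι → X → ℝ≥0∞} {η : ι → X → Measure Y}
    (hw : ∀ i, Measurable[universalCompletion X] (w i))
    (hη : ∀ i, Measurable[universalCompletion X] (η i)) :
    Measurable[universalCompletion X] fun x => ∑ i, w i x • η i x := by
  refine Measure.measurable_of_measurable_coe _ fun B hB => ?_
  simp only [Measure.coe_finsetSum, Finset.sum_apply, Measure.smul_apply, smul_eq_mul]
  exact Finset.measurable_fun_sum _ fun i _ =>
    (hw i).mul ((Measure.measurable_coe hB).comp (hη i))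

theorem universal_pi {ι : Type*} [Fintype ι] {E : ι → Type*} [∀ i, MeasurableSpace (E i)]
    {κ : ∀ i, X → Measure (E i)} [∀ i x, IsProbabilityMeasure (κ i x)]
    (hκ : ∀ i, Measurable[universalCompletion X] (κ i)) :
    Measurable[universalCompletion X] fun x => Measure.pi fun i => κ i x := by
  refine Measurable.measure_of_isPiSystem_of_isProbabilityMeasure generateFrom_pi.symm
    isPiSystem_pi ?_
  rintro _ ⟨s, hs, rfl⟩
  simp only [Measure.pi_pi]
  exact Finset.measurable_fun_prod _ fun i _ =>
    (Measure.measurable_coe (hs i (Set.mem_univ i))).comp (hκ i)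

end UniversalMeasurability

/-! ### Score laws and discernment -/

section Scores

theorem scoreLaw_apply (p : I) (s : Bool) :
    scoreLaw p s = ENNReal.ofReal (if s then (p : ℝ) else 1 - p) := by
  cases s
  · rw [scoreLaw, PMF.ofFintype_apply, if_neg Bool.false_ne_true, if_neg Bool.false_ne_true,
      ENNReal.ofReal, ENNReal.coe_inj]
    ext
    simp [Real.coe_toNNReal _ (sub_nonneg.2 p.2.2)]
  · rw [scoreLaw, PMF.ofFintype_apply, if_pos rfl, if_pos rfl, ENNReal.ofReal, ENNReal.coe_inj]
    ext
    simp [Real.coe_toNNReal _ p.2.1]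

theorem scoreLaw_true (p : I) : scoreLaw p true = ENNReal.ofReal p := by simp [scoreLaw_apply]

theorem scoreLaw_false (p : I) : scoreLaw p false = ENNReal.ofReal (1 - p) := by
  simp [scoreLaw_apply]

theorem measurable_scoreLaw (s : Bool) : Measurable fun p : I => scoreLaw p s := by
  simp only [scoreLaw_apply]
  cases s <;> simp <;> fun_prop

theorem sum_scoreLaw (p : I) : ∑ s, scoreLaw p s = 1 := by
  rw [← tsum_fintype (L := .unconditional _), PMF.tsum_coe]

theorem scoreLaw_injective : Function.Injective scoreLaw := fun p q h => by
  have := DFunLike.congr_fun h true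
  rwa [scoreLaw_true, scoreLaw_true, ENNReal.ofReal_eq_ofReal_iff p.2.1 q.2.1,
    Subtype.coe_inj] at this

theorem pmf_bool_false (k : PMF Bool) : k false = 1 - k true := by
  have h := k.tsum_coe
  rw [tsum_bool] at h
  exact ENNReal.eq_sub_of_add_eq (k.apply_ne_top _) h

theorem exists_eq_scoreLaw (k : PMF Bool) : ∃ c : I, k = scoreLaw c := by
  let c : I := ⟨(k true).toReal, ENNReal.toReal_nonneg,
    ENNReal.toReal_le_of_le_ofReal zero_le_one (by simpa using k.coe_le_one true)⟩
  have ht : k true = scoreLaw c true := by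
    rw [scoreLaw_true, ENNReal.ofReal_toReal (k.apply_ne_top _)]
  refine ⟨c, ?_⟩
  ext s
  cases s
  · rw [pmf_bool_false, pmf_bool_false, ← ht]
  · exact ht

theorem stochDominates_scoreLaw {p q : I} :
    StochDominates (scoreLaw p) (scoreLaw q) ↔ q ≤ p := by
  have hf : (Finset.univ.filter fun r : Bool => r ≤ false) = {false} := by decide
  have ht : (Finset.univ.filter fun r : Bool => r ≤ true) = Finset.univ := by decide
  simp only [StochDominates, Bool.forall_bool, hf, ht, Finset.sum_singleton, sum_scoreLaw, le_rfl,
    and_true, scoreLaw_false]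
  rw [ENNReal.ofReal_le_ofReal_iff (sub_nonneg.2 q.2.2), sub_le_sub_iff_left, Subtype.coe_le_coe]

/-- The convex combination of `c true` and `c false` with weights `p` and `1 - p`. -/
def mix (p : I) (c : Bool → I) : I :=
  ⟨p * c true + (1 - p) * c false, by
    have h1 := p.2; have h2 := (c true).2; have h3 := (c false).2
    simp only [Set.mem_Icc] at *
    constructor
    · nlinarith
    · nlinarith⟩

theorem coe_mix (p : I) (c : Bool → I) : (mix p c : ℝ) = p * c true + (1 - p) * c false := rfl

theorem sum_scoreLaw_mul (p : I) (c : Bool → I) (s' : Bool) :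
    ∑ s, scoreLaw p s * scoreLaw (c s) s' = scoreLaw (mix p c) s' := by
  have hp := p.2; have hc := (c true).2; have hc' := (c false).2
  simp only [Set.mem_Icc] at *
  rw [Fintype.sum_bool]
  simp only [scoreLaw_apply, coe_mix, if_true, Bool.false_eq_true, if_false]
  cases s'
  · simp only [Bool.false_eq_true, if_false]
    rw [← ENNReal.ofReal_mul (by linarith), ← ENNReal.ofReal_mul (by linarith),
      ← ENNReal.ofReal_add (by nlinarith) (by nlinarith)]
    congr 1
    ring
  · simp only [if_true]
    rw [← ENNReal.ofReal_mul (by linarith), ← ENNReal.ofReal_mul (by linarith),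
      ← ENNReal.ofReal_add (by nlinarith) (by nlinarith)]

theorem scoreLaw_bind (p : I) (c : Bool → I) :
    ((scoreLaw p).bind fun s => scoreLaw (c s)) = scoreLaw (mix p c) := by
  ext s'
  rw [PMF.bind_apply, tsum_fintype, sum_scoreLaw_mul]

variable {Θ T : Type*}

/-- A law on two scores is its mass on a pass, so a conversion is a pair of pass probabilities and
acts on passage rates by the affine map `mix`. -/
theorem moreDiscerning_iff {π : T × Θ → I} {θ : Θ} {τ ψ : T} :
    MoreDiscerning π θ τ ψ ↔ ∃ c : Bool → I, c false ≤ c true ∧ mix (π (τ, θ)) c = π (ψ, θ) ∧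
      ∀ θ', θ' ≠ θ → mix (π (τ, θ')) c ≤ π (ψ, θ') := by
  constructor
  · rintro ⟨k, hk⟩
    choose c hc using fun s => exists_eq_scoreLaw (k s)
    obtain rfl : k = fun s => scoreLaw (c s) := funext hc
    simp only [MonotoneConversion, scoreLaw_bind, stochDominates_scoreLaw] at hk
    exact ⟨c, hk.1, scoreLaw_injective hk.2.1, hk.2.2⟩
  · rintro ⟨c, hc⟩
    refine ⟨fun s => scoreLaw (c s), ?_⟩
    simp only [MonotoneConversion, scoreLaw_bind, stochDominates_scoreLaw]
    exact ⟨hc.1, congrArg _ hc.2.1, hc.2.2⟩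

theorem mix_mono {c : Bool → I} (hc : c false ≤ c true) {p p' : I} (h : p ≤ p') :
    mix p c ≤ mix p' c := by
  rw [← Subtype.coe_le_coe, coe_mix, coe_mix]
  have h1 : (c false : ℝ) ≤ c true := hc
  have h2 : (p : ℝ) ≤ p' := h
  nlinarith

/-- The slope that the type `x.2` forces on a conversion of the test `x.1.1` into the test
`x.1.2.2` which leaves the passage rate of the type `x.1.2.1` unchanged. -/
noncomputable def slopeBound (π : T × Θ → I) (x : (T × Θ × T) × Θ) : I :=
  if π (x.1.1, x.2) < π (x.1.1, x.1.2.1) then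
    Set.projIcc 0 1 zero_le_one (((π (x.1.2.2, x.1.2.1) : ℝ) - π (x.1.2.2, x.2)) /
      (π (x.1.1, x.1.2.1) - π (x.1.1, x.2)))
  else 0

/-- The least slope of a conversion of the test `x.1` into the test `x.2.2` which leaves the
passage rate of the type `x.2.1` unchanged and that of the other types not higher. -/
noncomputable def leastSlope (π : T × Θ → I) (x : T × Θ × T) : I :=
  ⨆ θ', slopeBound π (x, θ')

/-- The conversion of least slope: the probability of a pass as a function of the score. -/
noncomputable def conversion (π : T × Θ → I) (x : T × Θ × T) (s : Bool) : I :=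
  Set.projIcc 0 1 zero_le_one
    (π (x.2.2, x.2.1) + leastSlope π x * ((if s then 1 else 0) - π (x.1, x.2.1)) : ℝ)

/-- Conversions that fix the rate of `θ` are affine maps through one given point, with the slope as
only freedom. Types with a lower rate on `τ` bound the slope from below. All other constraints
(types with at least the rate of `θ`, values in the unit interval) relax as a nonnegative slope
falls. Hence, as soon as some conversion works, the least slope meeting the lower bounds works. -/
theorem conversion_spec {π : T × Θ → I} {θ : Θ} {τ ψ : T} (h : MoreDiscerning π θ τ ψ) :
    conversion π (τ, θ, ψ) false ≤ conversion π (τ, θ, ψ) true ∧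
      mix (π (τ, θ)) (conversion π (τ, θ, ψ)) = π (ψ, θ) ∧
      ∀ θ', mix (π (τ, θ')) (conversion π (τ, θ, ψ)) ≤ π (ψ, θ') := by
  obtain ⟨c, hc, hq, hle⟩ := moreDiscerning_iff.1 h
  have hq' := congrArg Subtype.val hq
  rw [coe_mix] at hq'
  have hc1 := (c true).2
  have hc0 := (c false).2
  have hp := (π (τ, θ)).2
  simp only [Set.mem_Icc] at hc1 hc0 hp
  have hcc : (c false : ℝ) ≤ c true := hc
  have hle' : ∀ θ', (π (τ, θ') : ℝ) * c true + (1 - π (τ, θ')) * c false ≤ π (ψ, θ') := by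
    intro θ'
    by_cases h : θ' = θ
    · rw [h]; exact hq'.le
    · exact hle θ' h
  have hbound : ∀ θ', slopeBound π ((τ, θ, ψ), θ') ≤
      Set.projIcc 0 1 zero_le_one ((c true : ℝ) - c false) := by
    intro θ'
    simp only [slopeBound]
    split_ifs with hlt
    · refine Set.monotone_projIcc _ ?_
      have hlt' : (π (τ, θ') : ℝ) < π (τ, θ) := hlt
      rw [div_le_iff₀ (by linarith)]
      have := hle' θ'
      linarith
    · exact bot_le
  have hs : (leastSlope π (τ, θ, ψ) : ℝ) ≤ c true - c false := by
    have h1 : leastSlope π (τ, θ, ψ) ≤ Set.projIcc 0 1 zero_le_one ((c true : ℝ) - c false) :=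
      iSup_le hbound
    have h2 : (Set.projIcc 0 1 zero_le_one ((c true : ℝ) - c false) : ℝ) = c true - c false := by
      rw [Set.projIcc_of_mem _ ⟨by linarith, by linarith⟩]
    rw [← h2]
    exact h1
  have hs0 := (leastSlope π (τ, θ, ψ)).2.1
  have hslope : ∀ θ', π (τ, θ') < π (τ, θ) → (π (ψ, θ) : ℝ) - π (ψ, θ') ≤
      leastSlope π (τ, θ, ψ) * (π (τ, θ) - π (τ, θ')) := by
    intro θ' hlt
    have hlt' : (π (τ, θ') : ℝ) < π (τ, θ) := hlt
    rw [← div_le_iff₀ (by linarith)]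
    have h1 : slopeBound π ((τ, θ, ψ), θ') ≤ leastSlope π (τ, θ, ψ) :=
      le_iSup (fun θ' => slopeBound π ((τ, θ, ψ), θ')) θ'
    simp only [slopeBound, if_pos hlt] at h1
    -- Clipping to the unit interval can then only raise the quotient, so the clipped bound still
    -- implies the true one.
    have h3 : ((π (ψ, θ) : ℝ) - π (ψ, θ')) / (π (τ, θ) - π (τ, θ')) ≤ 1 := by
      rw [div_le_iff₀ (by linarith)]
      have := hle' θ'
      nlinarith
    refine le_trans ?_ (Subtype.coe_le_coe.2 h1)
    rw [Set.coe_projIcc]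
    rw [min_eq_right h3]
    exact le_max_right _ _
  set s : ℝ := ((leastSlope π (τ, θ, ψ) : I) : ℝ)
  set p : ℝ := ((π (τ, θ) : I) : ℝ)
  set q : ℝ := ((π (ψ, θ) : I) : ℝ)
  -- The slope is at most that of the witness `c`, so the values already lie in the unit interval
  -- and the projection in `conversion` is inactive.
  have htrue : (conversion π (τ, θ, ψ) true : ℝ) = q + s * (1 - p) := by
    simp only [conversion, if_true]
    rw [Set.projIcc_of_mem]
    exact ⟨by nlinarith [(π (ψ, θ)).2.1], by nlinarith⟩
  have hfalse : (conversion π (τ, θ, ψ) false : ℝ) = q - s * p := by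
    simp only [conversion, Bool.false_eq_true, if_false]
    rw [Set.projIcc_of_mem]
    · change q + s * (0 - p) = _
      ring
    exact ⟨by nlinarith, by nlinarith [(π (ψ, θ)).2.2]⟩
  refine ⟨?_, ?_, fun θ' => ?_⟩
  · rw [← Subtype.coe_le_coe, htrue, hfalse]; nlinarith
  · ext
    rw [coe_mix, htrue, hfalse]
    change p * _ + (1 - p) * _ = q
    ring
  · rw [← Subtype.coe_le_coe, coe_mix, htrue, hfalse]
    by_cases hlt : π (τ, θ') < π (τ, θ)
    · have := hslope θ' hlt
      linarith
    · have h1 : p ≤ (π (τ, θ') : ℝ) := not_lt.1 hlt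
      have h2 := hle' θ'
      nlinarith

variable [MeasurableSpace Θ] [MeasurableSpace T]

theorem measurable_slopeBound {π : T × Θ → I} (hπ : Measurable π) :
    Measurable (slopeBound π) := by
  have h1 : Measurable fun x : (T × Θ × T) × Θ => π (x.1.1, x.2) := by fun_prop
  have h2 : Measurable fun x : (T × Θ × T) × Θ => π (x.1.1, x.1.2.1) := by fun_prop
  have h3 : Measurable fun x : (T × Θ × T) × Θ => π (x.1.2.2, x.1.2.1) := by fun_prop
  have h4 : Measurable fun x : (T × Θ × T) × Θ => π (x.1.2.2, x.2) := by fun_prop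
  refine Measurable.ite (measurableSet_lt h1 h2) ?_ measurable_const
  exact (continuous_projIcc (h := zero_le_one)).measurable.comp (by fun_prop)

/-- The supremum over types in `leastSlope` may be uncountable. It is what takes the construction
from Borel to universal measurability. -/
theorem universal_conversion [StandardBorelSpace Θ] [StandardBorelSpace T]
    {π : T × Θ → I} (hπ : Measurable π) (s : Bool) :
    Measurable[universalCompletion (T × Θ × T)] fun x => conversion π x s := by
  have h1 : Measurable[universalCompletion (T × Θ × T)] (leastSlope π) :=
    universal_iSup (measurable_slopeBound hπ)
  have h2 : Measurable fun x : T × Θ × T => π (x.1, x.2.1) := by fun_prop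
  have h3 : Measurable fun x : T × Θ × T => π (x.2.2, x.2.1) := by fun_prop
  refine (continuous_projIcc (h := zero_le_one)).measurable.comp ?_
  refine Measurable.add ?_ (Measurable.mul ?_ (Measurable.sub measurable_const ?_))
  · exact measurable_subtype_coe.comp (measurable_universalCompletion h3)
  · exact measurable_subtype_coe.comp h1
  · exact measurable_subtype_coe.comp (measurable_universalCompletion h2)

end Scores

/-! ### The direct mechanism -/

section DirectMechanism

open MeasurableSpace

variable {n : ℕ} {Θ M T : Fin n → Type*} {X : Type*} [∀ i, MeasurableSpace (Θ i)]
  [∀ i, MeasurableSpace (M i)] [∀ i, MeasurableSpace (T i)] [MeasurableSpace X]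

/-- The probability of the score profile `s` if agent `i` passes with probability `c i`. -/
noncomputable def scoreProb (c : Fin n → I) (s : Fin n → Bool) : ℝ≥0∞ :=
  ∏ i, scoreLaw (c i) (s i)

theorem sum_scoreProb (c : Fin n → I) : ∑ s, scoreProb c s = 1 := by
  simp only [scoreProb]
  rw [← Fintype.prod_sum fun i s => scoreLaw (c i) s]
  simp only [sum_scoreLaw, Finset.prod_const_one]

/-- Separate conversions keep independent scores independent: the sum over score profiles factors
over agents. -/
theorem sum_scoreProb_mul (p : Fin n → I) (c : Fin n → Bool → I) (s' : Fin n → Bool) :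
    ∑ s, scoreProb p s * scoreProb (fun i => c i (s i)) s' =
      scoreProb (fun i => mix (p i) (c i)) s' := by
  simp only [scoreProb, ← Finset.prod_mul_distrib, ← sum_scoreLaw_mul]
  rw [Fintype.prod_sum fun i s => scoreLaw (p i) s * scoreLaw (c i s) (s' i)]

theorem universal_scoreProb {Y : Type*} [MeasurableSpace Y] {c : Y → Fin n → I}
    (hc : ∀ i, Measurable[universalCompletion Y] fun y => c y i) (s : Fin n → Bool) :
    Measurable[universalCompletion Y] fun y => scoreProb (c y) s :=
  Finset.measurable_fun_prod _ fun i _ => (measurable_scoreLaw (s i)).comp (hc i)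

/-- The decision lottery after messages `m` and tests `τ` if agent `i` passes with
probability `c i`. -/
noncomputable def scoreLottery (mech : Mechanism M T X) (c : Fin n → I) (m : ∀ i, M i)
    (τ : ∀ i, T i) : Measure X :=
  ∑ s, scoreProb c s • mech.decision.1 (m, τ, s)

instance (mech : Mechanism M T X) (c : Fin n → I) (m : ∀ i, M i) (τ : ∀ i, T i) :
    IsProbabilityMeasure (scoreLottery mech c m τ) := ⟨by
  simp [scoreLottery, sum_scoreProb]⟩

theorem lintegral_scoreLottery (mech : Mechanism M T X) (c : Fin n → I) (m : ∀ i, M i)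
    (τ : ∀ i, T i) (φ : X → ℝ≥0∞) :
    ∫⁻ x, φ x ∂scoreLottery mech c m τ =
      ∑ s, scoreProb c s * ∫⁻ x, φ x ∂mech.decision.1 (m, τ, s) := by
  simp [scoreLottery, lintegral_finsetSum_measure, lintegral_smul_measure]

theorem outcomeExp_eq (π : ∀ i, T i × Θ i → I) (mech : Mechanism M T X)
    (str : ∀ i, Strategy (Θ i) (M i) (T i)) (θ : ∀ i, Θ i) (φ : X → ℝ≥0∞) :
    outcomeExp π mech str θ φ = ∫⁻ m, ∫⁻ τ, ∫⁻ x, φ x ∂scoreLottery mech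
      (fun i => (str i).effort (θ i, m i, τ i) * π i (τ i, θ i)) m τ
      ∂(mech.test.1 m) ∂(Measure.pi fun i => (str i).report.1 (θ i)) := by
  simp only [outcomeExp, lintegral_scoreLottery, scoreProb]

variable [∀ i, StandardBorelSpace (Θ i)] [∀ i, StandardBorelSpace (M i)]
  [∀ i, StandardBorelSpace (T i)]

theorem universal_scoreLottery {Y : Type*} [MeasurableSpace Y] (mech : Mechanism M T X)
    {c : Y → Fin n → I} (hc : ∀ i, Measurable[universalCompletion Y] fun y => c y i)
    {m : Y → ∀ i, M i} (hm : Measurable[universalCompletion Y] m) {τ : Y → ∀ i, T i}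
    (hτ : Measurable[universalCompletion Y] τ) :
    Measurable[universalCompletion Y] fun y => scoreLottery mech (c y) (m y) (τ y) :=
  universal_sum_smul (universal_scoreProb hc) fun _ =>
    universal_comp mech.decision.universal
      (Measurable.prodMk hm (Measurable.prodMk hτ measurable_const))

/-- The probability that agent `i` passes in the mechanism, given his type `θ`, message `m`, test
`τ` and score `s` on the test `tHat θ` of the direct mechanism. -/
noncomputable def convertedPass {Θ M T : Type*} [MeasurableSpace Θ] [MeasurableSpace M]
    [MeasurableSpace T] (π : T × Θ → I) (tHat : Θ → T) (st : Strategy Θ M T) (θ : Θ) (m : M)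
    (τ : T) (s : Bool) : I :=
  st.effort (θ, m, τ) * conversion π (tHat θ, θ, τ) s

theorem universal_convertedPass {Θ M T : Type*} [MeasurableSpace Θ] [MeasurableSpace M]
    [MeasurableSpace T] [StandardBorelSpace Θ] [StandardBorelSpace T] {π : T × Θ → I}
    (hπ : Measurable π) {tHat : Θ → T} (htHat : Measurable[universalCompletion Θ] tHat)
    (st : Strategy Θ M T) (s : Bool) : Measurable[universalCompletion (Θ × M × T)] fun z =>
      convertedPass π tHat st z.1 z.2.1 z.2.2 s := by
  have h1 : Measurable[universalCompletion (Θ × M × T)] fun z : Θ × M × T => z.1 :=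
    measurable_universalCompletion measurable_fst
  have h2 : Measurable[universalCompletion (Θ × M × T)] fun z : Θ × M × T => z.2.2 :=
    measurable_universalCompletion (measurable_snd.comp measurable_snd)
  exact Measurable.mul st.measurable_effort (universal_comp (g := fun x => conversion π x s)
    (universal_conversion hπ s)
    (Measurable.prodMk (universal_comp htHat h1) (Measurable.prodMk h1 h2)))

/-- The decision lottery of the direct mechanism after the scores `s` and the reports `θ`. -/
noncomputable def directLottery (π : ∀ i, T i × Θ i → I) (tHat : ∀ i, Θ i → T i)
    (mech : Mechanism M T X) (str : ∀ i, Strategy (Θ i) (M i) (T i)) (s : Fin n → Bool)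
    (θ : ∀ i, Θ i) : Measure X :=
  (Measure.pi fun i => (str i).report.1 (θ i)).bind fun m => (mech.test.1 m).bind fun τ =>
    scoreLottery mech (fun i => convertedPass (π i) (tHat i) (str i) (θ i) (m i) (τ i) (s i)) m τ

variable {π : ∀ i, T i × Θ i → I} {tHat : ∀ i, Θ i → T i}

theorem universal_scoreLottery_convertedPass (hπ : ∀ i, Measurable (π i))
    (htHat : ∀ i, Measurable[universalCompletion (Θ i)] (tHat i)) (mech : Mechanism M T X)
    (str : ∀ i, Strategy (Θ i) (M i) (T i)) (s : Fin n → Bool) :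
    Measurable[universalCompletion (((∀ i, Θ i) × (∀ i, M i)) × (∀ i, T i))] fun z =>
      scoreLottery mech (fun i => convertedPass (π i) (tHat i) (str i) (z.1.1 i) (z.1.2 i) (z.2 i)
        (s i)) z.1.2 z.2 := by
  refine universal_scoreLottery mech (fun i => ?_) (measurable_universalCompletion (by fun_prop))
    (measurable_universalCompletion (by fun_prop))
  exact universal_comp (universal_convertedPass (hπ i) (htHat i) (str i) (s i))
    (f := fun z : ((∀ i, Θ i) × (∀ i, M i)) × (∀ i, T i) => (z.1.1 i, z.1.2 i, z.2 i))
    (measurable_universalCompletion (by fun_prop))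

variable [CountablyGenerated X]

theorem universal_directLottery_inner (hπ : ∀ i, Measurable (π i))
    (htHat : ∀ i, Measurable[universalCompletion (Θ i)] (tHat i)) (mech : Mechanism M T X)
    (str : ∀ i, Strategy (Θ i) (M i) (T i)) (s : Fin n → Bool) :
    Measurable[universalCompletion ((∀ i, Θ i) × (∀ i, M i))] fun z =>
      (mech.test.1 z.2).bind fun τ => scoreLottery mech (fun i =>
        convertedPass (π i) (tHat i) (str i) (z.1 i) (z.2 i) (τ i) (s i)) z.2 τ :=
  universal_bind (κ := fun z : (∀ i, Θ i) × (∀ i, M i) => mech.test.1 z.2)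
    (η := fun z => scoreLottery mech (fun i => convertedPass (π i) (tHat i) (str i) (z.1.1 i)
      (z.1.2 i) (z.2 i) (s i)) z.1.2 z.2)
    (universal_comp mech.test.universal (measurable_universalCompletion measurable_snd))
    (universal_scoreLottery_convertedPass hπ htHat mech str s)

theorem isProbabilityMeasure_directLottery_inner (hπ : ∀ i, Measurable (π i))
    (htHat : ∀ i, Measurable[universalCompletion (Θ i)] (tHat i)) (mech : Mechanism M T X)
    (str : ∀ i, Strategy (Θ i) (M i) (T i)) (s : Fin n → Bool) (θ : ∀ i, Θ i) (m : ∀ i, M i) :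
    IsProbabilityMeasure ((mech.test.1 m).bind fun τ => scoreLottery mech (fun i =>
        convertedPass (π i) (tHat i) (str i) (θ i) (m i) (τ i) (s i)) m τ) :=
  isProbabilityMeasure_bind_universal (universal_section
    (universal_scoreLottery_convertedPass hπ htHat mech str s) (θ, m))

theorem universal_directLottery (hπ : ∀ i, Measurable (π i))
    (htHat : ∀ i, Measurable[universalCompletion (Θ i)] (tHat i)) (mech : Mechanism M T X)
    (str : ∀ i, Strategy (Θ i) (M i) (T i)) (s : Fin n → Bool) :
    Measurable[universalCompletion (∀ i, Θ i)] (directLottery π tHat mech str s) := by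
  have := isProbabilityMeasure_directLottery_inner hπ htHat mech str s
  exact universal_bind (κ := fun θ : ∀ i, Θ i => Measure.pi fun i => (str i).report.1 (θ i))
    (η := fun z => (mech.test.1 z.2).bind fun τ => scoreLottery mech (fun i =>
        convertedPass (π i) (tHat i) (str i) (z.1 i) (z.2 i) (τ i) (s i)) z.2 τ)
    (universal_pi fun i => universal_comp (str i).report.universal
      (measurable_universalCompletion (measurable_pi_apply i)))
    (universal_directLottery_inner hπ htHat mech str s)

theorem isProbabilityMeasure_directLottery (hπ : ∀ i, Measurable (π i))
    (htHat : ∀ i, Measurable[universalCompletion (Θ i)] (tHat i)) (mech : Mechanism M T X)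
    (str : ∀ i, Strategy (Θ i) (M i) (T i)) (s : Fin n → Bool) (θ : ∀ i, Θ i) :
    IsProbabilityMeasure (directLottery π tHat mech str s θ) := by
  have := isProbabilityMeasure_directLottery_inner hπ htHat mech str s
  exact isProbabilityMeasure_bind_universal
    (universal_section (universal_directLottery_inner hπ htHat mech str s) θ)

theorem lintegral_directLottery (hπ : ∀ i, Measurable (π i))
    (htHat : ∀ i, Measurable[universalCompletion (Θ i)] (tHat i)) (mech : Mechanism M T X)
    (str : ∀ i, Strategy (Θ i) (M i) (T i)) (s : Fin n → Bool) (θ : ∀ i, Θ i) {φ : X → ℝ≥0∞}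
    (hφ : Measurable φ) : ∫⁻ x, φ x ∂directLottery π tHat mech str s θ =
      ∫⁻ m, ∫⁻ τ, ∫⁻ x, φ x ∂scoreLottery mech (fun i =>
        convertedPass (π i) (tHat i) (str i) (θ i) (m i) (τ i) (s i)) m τ
      ∂(mech.test.1 m) ∂(Measure.pi fun i => (str i).report.1 (θ i)) := by
  have := isProbabilityMeasure_directLottery_inner hπ htHat mech str s
  rw [directLottery, lintegral_bind_universal
    (universal_section (universal_directLottery_inner hπ htHat mech str s) θ) hφ]
  refine lintegral_congr fun m => ?_
  exact lintegral_bind_universal (universal_section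
    (universal_scoreLottery_convertedPass hπ htHat mech str s) (θ, m)) hφ

/-- If the agents report `θr` and pass with probabilities `p` in the direct mechanism, then the
decision has the same law as in the mechanism if the type profile is `θ` and the strategies are
`str₂`, provided that these induce the messages of `θr` and the converted probabilities. -/
theorem sum_lintegral_directLottery (hπ : ∀ i, Measurable (π i))
    (htHat : ∀ i, Measurable[universalCompletion (Θ i)] (tHat i)) (mech : Mechanism M T X)
    (str str₂ : ∀ i, Strategy (Θ i) (M i) (T i)) (θr θ : ∀ i, Θ i) (p : Fin n → I)
    (hreport : ∀ i, (str₂ i).report.1 (θ i) = (str i).report.1 (θr i))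
    (hpass : ∀ i m τ, (str₂ i).effort (θ i, m, τ) * π i (τ, θ i) =
      (str i).effort (θr i, m, τ) * mix (p i) (conversion (π i) (tHat i (θr i), θr i, τ)))
    {φ : X → ℝ≥0∞} (hφ : Measurable φ) :
    ∑ s, scoreProb p s * ∫⁻ x, φ x ∂directLottery π tHat mech str s θr =
      outcomeExp π mech str₂ θ φ := by
  have hint : ∀ s : Fin n → Bool, Measurable[universalCompletion ((∀ i, M i) × (∀ i, T i))] fun z =>
      ∫⁻ x, φ x ∂scoreLottery mech (fun i => convertedPass (π i) (tHat i) (str i) (θr i) (z.1 i)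
        (z.2 i) (s i)) z.1 z.2 := fun s =>
    (Measure.measurable_lintegral hφ).comp (universal_comp
      (universal_scoreLottery_convertedPass hπ htHat mech str s)
      (f := fun z : (∀ i, M i) × (∀ i, T i) => ((θr, z.1), z.2))
      (measurable_universalCompletion (by fun_prop)))
  have hinner : ∀ s : Fin n → Bool, Measurable[universalCompletion (∀ i, M i)] fun m =>
      ∫⁻ τ, ∫⁻ x, φ x ∂scoreLottery mech (fun i => convertedPass (π i) (tHat i) (str i) (θr i) (m i)
        (τ i) (s i)) m τ ∂mech.test.1 m := fun s =>
    universal_lintegral mech.test.universal (hint s)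
  simp only [lintegral_directLottery hπ htHat mech str _ _ hφ]
  rw [outcomeExp_eq]
  simp only [hreport]
  rw [Finset.sum_congr rfl fun s _ => (lintegral_const_mul'' (scoreProb p s)
      (aemeasurable_of_universal (hinner s) _)).symm,
    ← lintegral_finsetSum' _ fun s _ => (aemeasurable_of_universal (hinner s) _).const_mul _]
  refine lintegral_congr fun m => ?_
  have hm : ∀ s : Fin n → Bool, AEMeasurable (fun τ => ∫⁻ x, φ x ∂scoreLottery mech (fun i =>
      convertedPass (π i) (tHat i) (str i) (θr i) (m i) (τ i) (s i)) m τ) (mech.test.1 m) :=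
    fun s => aemeasurable_of_universal (universal_section (hint s) m) _
  rw [Finset.sum_congr rfl fun s _ => (lintegral_const_mul'' (scoreProb p s) (hm s)).symm,
    ← lintegral_finsetSum' _ fun s _ => (hm s).const_mul _]
  refine lintegral_congr fun τ => ?_
  simp only [lintegral_scoreLottery, Finset.mul_sum]
  rw [Finset.sum_comm]
  refine Finset.sum_congr rfl fun s' _ => ?_
  simp only [← mul_assoc, ← Finset.sum_mul]
  congr 1
  -- With messages and tests fixed, only the laws of the simulated scores remain. The effort factor
  -- comes out of `mix` by linearity, and `hpass` identifies the rates.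
  rw [sum_scoreProb_mul p (fun i s => convertedPass (π i) (tHat i) (str i) (θr i) (m i) (τ i) s)]
  congr 1
  ext i
  rw [hpass, coe_mix]
  simp only [convertedPass, Set.Icc.coe_mul, coe_mix]
  ring

end DirectMechanism

/-! ### Most discerning testing functions suffice -/

section DiracProducts

variable {ι : Type*} [Fintype ι] {E : ι → Type*} [∀ i, MeasurableSpace (E i)]

theorem pi_dirac (θ : ∀ i, E i) : Measure.pi (fun i => Measure.dirac (θ i)) = Measure.dirac θ := by
  classical
  refine Measure.pi_eq fun s hs => ?_
  rw [Measure.dirac_apply' _ (MeasurableSet.univ_pi hs)]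
  simp only [Measure.dirac_apply' _ (hs _), Set.indicator_apply, Pi.one_apply, Set.mem_univ_pi]
  rw [Finset.prod_ite_zero]
  simp

/-- Serves unilateral deviations: when all others report truthfully, the message profile is random
in coordinate `i` only. -/
theorem pi_eq_map_update [DecidableEq ι] (θ : ∀ i, E i) (i : ι) (κ : ∀ i, Measure (E i))
    [∀ i, IsProbabilityMeasure (κ i)] (hκ : ∀ j, j ≠ i → κ j = Measure.dirac (θ j)) :
    Measure.pi κ = (κ i).map (Function.update θ i) := by
  classical
  refine Measure.pi_eq fun s hs => ?_
  rw [Measure.map_apply (measurable_update θ) (MeasurableSet.univ_pi hs),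
    ← Finset.mul_prod_erase _ _ (Finset.mem_univ i)]
  have h : ∀ j ∈ Finset.univ.erase i, κ j (s j) = if θ j ∈ s j then 1 else 0 := by
    intro j hj
    rw [hκ j (Finset.ne_of_mem_erase hj), Measure.dirac_apply' _ (hs j)]
    simp [Set.indicator_apply]
  rw [Finset.prod_congr rfl h, Finset.prod_ite_zero]
  simp only [Finset.prod_const_one, mul_ite, mul_one, mul_zero, Finset.mem_erase, Finset.mem_univ,
    and_true]
  split_ifs with hθ
  · congr 1
    ext x
    simp only [Set.mem_preimage, Set.mem_univ_pi]
    refine ⟨fun h => by simpa using h i, fun hx j => ?_⟩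
    rcases eq_or_ne j i with rfl | hj
    · simpa using hx
    · simpa [hj] using hθ j hj
  · refine measure_mono_null (t := ∅) (fun x hx => hθ fun j hj => ?_) measure_empty
    simpa [hj] using hx j (Set.mem_univ j)

end DiracProducts

section Sufficiency

open MeasurableSpace

/-- The strategy that reports truthfully and always exerts effort. -/
noncomputable def truthful (Θ T : Type*) [MeasurableSpace Θ] [MeasurableSpace T] :
    Strategy Θ Θ T where
  report := Transition.mk Measure.dirac (measurable_universalCompletion Measure.measurable_dirac)
    fun _ => inferInstance
  effort _ := 1
  measurable_effort := measurable_const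

theorem universal_tHat {ι : Type*} {Θ T : ι → Type*} [Countable ι] [∀ i, MeasurableSpace (Θ i)]
    [∀ i, MeasurableSpace (T i)] [∀ i, StandardBorelSpace (Θ i)] {tHat : ∀ i, Θ i → T i}
    (htHat : ∀ i, Measurable[universalCompletion (Θ i)] (tHat i)) :
    Measurable[universalCompletion (∀ i, Θ i)] fun θ i => tHat i (θ i) :=
  @measurable_pi_lambda _ _ _ (universalCompletion (∀ i, Θ i)) _ _ fun i =>
    universal_comp (htHat i) (measurable_universalCompletion (measurable_pi_apply i))

/-! ### Imitating, in the original mechanism, a deviation from the direct one. -/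

section Imitation

variable {Θ M T : Type*} [MeasurableSpace Θ] [MeasurableSpace M] [MeasurableSpace T]
  [StandardBorelSpace Θ] [StandardBorelSpace M] [StandardBorelSpace T]

/-- The strategy of type `t` that sends the messages of type `θ'` and passes each test as if the
test `tHat θ'` had been taken with effort `e` and the score had been converted. -/
noncomputable def imitate {π : T × Θ → I} (hπ : Measurable π) (tHat : Θ → T)
    (st : Strategy Θ M T) (t θ' : Θ) (e : I) : Strategy Θ M T where
  report := Transition.mk (fun _ => st.report.1 θ') measurable_const fun _ => inferInstance
  -- The second factor is the share of the own passage rate that is needed to hit the converted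
  -- rate.
  effort z := st.effort (θ', z.2.1, z.2.2) * Set.projIcc 0 1 zero_le_one
    ((mix (e * π (tHat θ', t)) (conversion π (tHat θ', θ', z.2.2)) : ℝ) / π (z.2.2, t))
  measurable_effort := by
    have h1 : Measurable[universalCompletion (Θ × M × T)] fun z : Θ × M × T => z.2.2 :=
      measurable_universalCompletion (by fun_prop)
    have h2 : ∀ s, Measurable[universalCompletion (Θ × M × T)] fun z : Θ × M × T =>
        conversion π (tHat θ', θ', z.2.2) s := fun s =>
      universal_comp (g := fun x => conversion π x s) (universal_conversion hπ s)
        (Measurable.prodMk measurable_const (Measurable.prodMk measurable_const h1))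
    have h3 : Measurable[universalCompletion (Θ × M × T)] fun z : Θ × M × T => π (z.2.2, t) :=
      hπ.comp (Measurable.prodMk h1 measurable_const)
    refine Measurable.mul ?_ ((continuous_projIcc (h := zero_le_one)).measurable.comp ?_)
    · exact universal_comp st.measurable_effort (f := fun z : Θ × M × T => (θ', z.2.1, z.2.2))
        (measurable_universalCompletion (by fun_prop))
    · refine Measurable.div ?_ (measurable_subtype_coe.comp h3)
      exact ((measurable_subtype_coe.comp (h2 true)).const_mul _).add
        ((measurable_subtype_coe.comp (h2 false)).const_mul _)

theorem imitate_report {π : T × Θ → I} (hπ : Measurable π) (tHat : Θ → T)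
    (st : Strategy Θ M T) (t θ' θ : Θ) (e : I) :
    (imitate hπ tHat st t θ' e).report.1 θ = st.report.1 θ' := rfl

/-- Discernment keeps the converted rate of type `t` under full effort at most `π (τ, t)`, and
monotonicity of the conversion extends this to every effort `e`. A target below the own passage rate
is reached by lowering effort. -/
theorem imitate_effort_mul {π : T × Θ → I} (hπ : Measurable π) {tHat : Θ → T}
    (hd : MostDiscerning π tHat) (st : Strategy Θ M T) (t θ' θ : Θ) (e : I) (m : M) (τ : T) :
    (imitate hπ tHat st t θ' e).effort (θ, m, τ) * π (τ, t) =
      st.effort (θ', m, τ) * mix (e * π (tHat θ', t)) (conversion π (tHat θ', θ', τ)) := by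
  obtain ⟨h1, -, h3⟩ := conversion_spec (hd θ' τ)
  have hle : mix (e * π (tHat θ', t)) (conversion π (tHat θ', θ', τ)) ≤ π (τ, t) :=
    (mix_mono h1 unitInterval.mul_le_right).trans (h3 t)
  set c := mix (e * π (tHat θ', t)) (conversion π (tHat θ', θ', τ))
  have hle' : (c : ℝ) ≤ π (τ, t) := hle
  have hc := c.2.1
  ext
  simp only [imitate, Set.Icc.coe_mul, mul_assoc]
  congr 1
  -- At passage rate zero the quotient in `imitate` is meaningless, but the target is then zero as
  -- well.
  rcases (π (τ, t)).2.1.eq_or_lt with h0 | h0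
  · rw [← h0] at hle' ⊢
    rw [mul_zero]
    linarith
  · rw [Set.projIcc_of_mem zero_le_one ⟨div_nonneg hc h0.le, (div_le_one h0).2 hle'⟩]
    exact div_mul_cancel₀ _ h0.ne'

end Imitation

variable {n : ℕ} {Θ M T : Fin n → Type*} {X : Type*} [∀ i, MeasurableSpace (Θ i)]
  [∀ i, MeasurableSpace (M i)] [∀ i, MeasurableSpace (T i)] [MeasurableSpace X]
  [∀ i, StandardBorelSpace (Θ i)] [∀ i, StandardBorelSpace (M i)]
  [∀ i, StandardBorelSpace (T i)] [CountablyGenerated X]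
  {π : ∀ i, T i × Θ i → I} {tHat : ∀ i, Θ i → T i}

/-- The direct mechanism that runs `mech` on the messages of the reported types, with the scores
on the tests `tHat` converted into scores on the tests of `mech`. -/
noncomputable def directMechanism (hπ : ∀ i, Measurable (π i))
    (htHat : ∀ i, Measurable[universalCompletion (Θ i)] (tHat i)) (mech : Mechanism M T X)
    (str : ∀ i, Strategy (Θ i) (M i) (T i)) : Mechanism Θ T X where
  test := Transition.mk (fun θ => Measure.dirac fun i => tHat i (θ i))
    (Measure.measurable_dirac.comp (universal_tHat htHat)) fun _ => inferInstance
  decision := Transition.mk (fun y => directLottery π tHat mech str y.2.2 y.1)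
    (universal_of_countable_cases
      (e := fun y : (∀ i, Θ i) × (∀ i, T i) × (Fin n → Bool) => y.2.2) (by fun_prop)
      (f := fun s y => directLottery π tHat mech str s y.1) fun s =>
      universal_comp (universal_directLottery hπ htHat mech str s)
        (measurable_universalCompletion measurable_fst))
    fun y => isProbabilityMeasure_directLottery hπ htHat mech str y.2.2 y.1

/-- The expectation of `φ` of the decision in the direct mechanism if the types are `θ`, the
reports are `m` and efforts are given by `strD`. -/
noncomputable def reportExp (π : ∀ i, T i × Θ i → I) (tHat : ∀ i, Θ i → T i)
    (mech : Mechanism M T X) (str : ∀ i, Strategy (Θ i) (M i) (T i))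
    (strD : ∀ i, Strategy (Θ i) (Θ i) (T i)) (φ : X → ℝ≥0∞) (θ m : ∀ i, Θ i) : ℝ≥0∞ :=
  ∑ s, scoreProb
    (fun i => (strD i).effort (θ i, m i, tHat i (m i)) * π i (tHat i (m i), θ i)) s *
      ∫⁻ x, φ x ∂directLottery π tHat mech str s m

theorem outcomeExp_directMechanism (hπ : ∀ i, Measurable (π i))
    (htHat : ∀ i, Measurable[universalCompletion (Θ i)] (tHat i)) (mech : Mechanism M T X)
    (str : ∀ i, Strategy (Θ i) (M i) (T i)) (strD : ∀ i, Strategy (Θ i) (Θ i) (T i))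
    (θ : ∀ i, Θ i) (φ : X → ℝ≥0∞) :
    outcomeExp π (directMechanism hπ htHat mech str) strD θ φ =
      ∫⁻ m, reportExp π tHat mech str strD φ θ m
        ∂(Measure.pi fun i => (strD i).report.1 (θ i)) := by
  simp only [outcomeExp, directMechanism, Transition.mk_apply, lintegral_dirac, reportExp,
    scoreProb]

theorem universal_reportExp (hπ : ∀ i, Measurable (π i))
    (htHat : ∀ i, Measurable[universalCompletion (Θ i)] (tHat i)) (mech : Mechanism M T X)
    (str : ∀ i, Strategy (Θ i) (M i) (T i)) (strD : ∀ i, Strategy (Θ i) (Θ i) (T i))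
    {φ : X × (∀ i, Θ i) → ℝ≥0∞} (hφ : Measurable φ) :
    Measurable[universalCompletion ((∀ i, Θ i) × (∀ i, Θ i))] fun z =>
      reportExp π tHat mech str strD (fun x => φ (x, z.1)) z.1 z.2 := by
  have := isProbabilityMeasure_directLottery hπ htHat mech str
  have h1 : ∀ i, Measurable[universalCompletion ((∀ i, Θ i) × (∀ i, Θ i))]
      fun z : (∀ i, Θ i) × (∀ i, Θ i) => z.1 i := fun i =>
    measurable_universalCompletion (by fun_prop)
  have h2 : ∀ i, Measurable[universalCompletion ((∀ i, Θ i) × (∀ i, Θ i))]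
      fun z : (∀ i, Θ i) × (∀ i, Θ i) => z.2 i := fun i =>
    measurable_universalCompletion (by fun_prop)
  have h3 := fun i => universal_comp (htHat i) (h2 i)
  refine Finset.measurable_fun_sum _ fun s _ => Measurable.mul (universal_scoreProb (fun i =>
    Measurable.mul
      (universal_comp (strD i).measurable_effort ((h1 i).prodMk ((h2 i).prodMk (h3 i))))
      ((hπ i).comp ((h3 i).prodMk (h1 i)))) s) ?_
  exact universal_lintegral
    (κ := fun z : (∀ i, Θ i) × (∀ i, Θ i) => directLottery π tHat mech str s z.2)
    (universal_comp (universal_directLottery hπ htHat mech str s)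
      (measurable_universalCompletion measurable_snd))
    (f := fun y => φ (y.2, y.1.1)) (measurable_universalCompletion (by fun_prop))

/-- Each conversion restores exactly the passage rate of the truthful type on the drawn test, and
the original effort is built into `directLottery`. -/
theorem outcomeExp_truthful (hπ : ∀ i, Measurable (π i))
    (htHat : ∀ i, Measurable[universalCompletion (Θ i)] (tHat i))
    (hd : ∀ i, MostDiscerning (π i) (tHat i)) (mech : Mechanism M T X)
    (str : ∀ i, Strategy (Θ i) (M i) (T i)) (θ : ∀ i, Θ i) {φ : X → ℝ≥0∞} (hφ : Measurable φ) :
    outcomeExp π (directMechanism hπ htHat mech str) (fun i => truthful (Θ i) (T i)) θ φ =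
      outcomeExp π mech str θ φ := by
  rw [outcomeExp_directMechanism]
  simp only [truthful, Transition.mk_apply]
  rw [pi_dirac, lintegral_dirac]
  refine sum_lintegral_directLottery hπ htHat mech str str θ θ _ (fun _ => rfl)
    (fun i m τ => ?_) hφ
  rw [one_mul, (conversion_spec (hd i (θ i) τ)).2.1]

/-- Once the report `x` is fixed, the deviation in the direct mechanism matters only through the
effort on `tHat i x`, and one imitating strategy in `mech` has the same effect. -/
theorem reportExp_update_truthful (hπ : ∀ i, Measurable (π i))
    (htHat : ∀ i, Measurable[universalCompletion (Θ i)] (tHat i))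
    (hd : ∀ i, MostDiscerning (π i) (tHat i)) (mech : Mechanism M T X)
    (str : ∀ i, Strategy (Θ i) (M i) (T i)) (i : Fin n) (st : Strategy (Θ i) (Θ i) (T i))
    (t : Θ i) (θ : ∀ i, Θ i) {φ : X → ℝ≥0∞} (hφ : Measurable φ) (x : Θ i) :
    reportExp π tHat mech str (Function.update (fun i => truthful (Θ i) (T i)) i st) φ
        (Function.update θ i t) (Function.update θ i x) =
      outcomeExp π mech (Function.update str i
        (imitate (hπ i) (tHat i) (str i) t x (st.effort (t, x, tHat i x))))
        (Function.update θ i t) φ := by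
  refine sum_lintegral_directLottery hπ htHat mech str _ _ _ _ (fun j => ?_) (fun j m τ => ?_) hφ
  · rcases eq_or_ne j i with rfl | hj
    · simp [imitate_report]
    · simp [hj]
  · rcases eq_or_ne j i with rfl | hj
    · simp only [Function.update_self]
      exact imitate_effort_mul (hπ j) (hd j) _ _ _ _ _ _ _
    · simp only [Function.update_of_ne hj, truthful, one_mul]
      rw [(conversion_spec (hd j (θ j) τ)).2.1]

theorem interimExp_update_truthful (μ : ∀ i, Measure (Θ i)) [∀ i, IsProbabilityMeasure (μ i)]
    (hπ : ∀ i, Measurable (π i))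
    (htHat : ∀ i, Measurable[universalCompletion (Θ i)] (tHat i))
    (hd : ∀ i, MostDiscerning (π i) (tHat i)) (mech : Mechanism M T X)
    (str : ∀ i, Strategy (Θ i) (M i) (T i)) (i : Fin n) (st : Strategy (Θ i) (Θ i) (T i))
    (t : Θ i) {φ : X × (∀ i, Θ i) → ℝ≥0∞} (hφ : Measurable φ) :
    interimExp μ π (directMechanism hπ htHat mech str)
        (Function.update (fun i => truthful (Θ i) (T i)) i st) i t φ =
      ∫⁻ x, interimExp μ π mech (Function.update str i
        (imitate (hπ i) (tHat i) (str i) t x (st.effort (t, x, tHat i x)))) i t φ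
        ∂st.report.1 t := by
  set strD := Function.update (fun i => truthful (Θ i) (T i)) i st with hstrD
  have hmeas : Measurable[universalCompletion ((∀ i, Θ i) × Θ i)] fun z : (∀ i, Θ i) × Θ i =>
      reportExp π tHat mech str strD (fun x => φ (x, Function.update z.1 i t))
        (Function.update z.1 i t) (Function.update z.1 i z.2) :=
    universal_comp (universal_reportExp hπ htHat mech str strD hφ)
      (f := fun z : (∀ i, Θ i) × Θ i => (Function.update z.1 i t, Function.update z.1 i z.2))
      (measurable_universalCompletion
        ((measurable_update_left.comp measurable_fst).prodMk measurable_update'))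
  have hout : ∀ θ : ∀ i, Θ i, outcomeExp π (directMechanism hπ htHat mech str) strD
      (Function.update θ i t) (fun x => φ (x, Function.update θ i t)) =
      ∫⁻ x, reportExp π tHat mech str strD (fun x => φ (x, Function.update θ i t))
        (Function.update θ i t) (Function.update θ i x) ∂st.report.1 t := by
    intro θ
    have := Measure.isProbabilityMeasure_map (μ := (strD i).report.1 (Function.update θ i t i))
      (measurable_update θ).aemeasurable
    rw [outcomeExp_directMechanism, pi_eq_map_update θ i, lintegral_map']
    · simp [hstrD]
    · exact aemeasurable_of_universal (universal_section
        (universal_reportExp hπ htHat mech str strD hφ) _) _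
    · exact (measurable_update θ).aemeasurable
    · intro j hj
      simp [hstrD, hj, truthful]
  simp only [interimExp, hout]
  -- With the report integrated last, each fixed `x` leaves the interim expectation of one deviation
  -- in `mech`. No measurable combination of these deviations into one strategy is needed.
  rw [lintegral_lintegral_swap (aemeasurable_of_universal hmeas _)]
  refine lintegral_congr fun x => lintegral_congr fun θ => ?_
  exact reportExp_update_truthful hπ htHat hd mech str i st t θ (by fun_prop) x

/-- A deviation that is a mixture of unprofitable deviations is unprofitable. -/
theorem lintegral_sub_lintegral_le {Y : Type*} [MeasurableSpace Y] (ρ : Measure Y)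
    [IsProbabilityMeasure ρ] {G L : Y → ℝ≥0∞} {g l : ℝ≥0∞} (hl : l ≠ ∞)
    (h : ∀ y, (G y : EReal) - (L y : EReal) ≤ (g : EReal) - (l : EReal)) :
    ((∫⁻ y, G y ∂ρ : ℝ≥0∞) : EReal) - ((∫⁻ y, L y ∂ρ : ℝ≥0∞) : EReal) ≤
      (g : EReal) - (l : EReal) := by
  -- Without subtraction the inequality integrates in `ℝ≥0∞`, with no measurability or integrability
  -- of `G` and `L`.
  have hiff : ∀ a b : ℝ≥0∞, b ≠ ∞ →
      ((a : EReal) - (b : EReal) ≤ (g : EReal) - (l : EReal) ↔ a + l ≤ g + b) := by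
    intro a b hb
    rw [EReal.le_sub_iff_add_le (by simp) (by simp [hl]), sub_eq_add_neg, add_right_comm,
      ← sub_eq_add_neg, EReal.sub_le_iff_le_add (by simp) (by simp [hb])]
    norm_cast
  have hadd : ∀ y, G y + l ≤ g + L y := by
    intro y
    by_cases hL : L y = ∞
    · simp [hL]
    exact (hiff _ _ hL).1 (h y)
  have hint : ∫⁻ y, G y ∂ρ + l ≤ g + ∫⁻ y, L y ∂ρ := by
    have := lintegral_mono (μ := ρ) hadd
    rw [lintegral_add_right _ measurable_const, lintegral_add_left measurable_const] at this
    simpa using this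
  -- An infinite loss makes the left side `⊥`, even against an infinite gain, in line with the
  -- convention for undefined utilities.
  by_cases hL : ∫⁻ y, L y ∂ρ = ∞
  · simp [hL]
  · exact (hiff _ _ hL).2 hint

theorem canonicallyImplementableWith_of_implements (μ : ∀ i, Measure (Θ i))
    [∀ i, IsProbabilityMeasure (μ i)] (hπ : ∀ i, Measurable (π i))
    (htHat : ∀ i, Measurable[universalCompletion (Θ i)] (tHat i))
    (hd : ∀ i, MostDiscerning (π i) (tHat i)) {mech : Mechanism M T X}
    {str : ∀ i, Strategy (Θ i) (M i) (T i)} {u : Fin n → X × (∀ i, Θ i) → ℝ}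
    (hu : ∀ i, Measurable (u i)) {f : Transition (∀ i, Θ i) X}
    (h : Implements μ π u mech str f) :
    CanonicallyImplementableWith μ π u (fun θ i => tHat i (θ i)) f := by
  have htrue : ∀ (i : Fin n) (t : Θ i) {φ : X × (∀ i, Θ i) → ℝ≥0∞}, Measurable φ →
      interimExp μ π (directMechanism hπ htHat mech str) (fun i => truthful (Θ i) (T i)) i t φ =
        interimExp μ π mech str i t φ := fun i t φ hφ =>
    lintegral_congr fun θ => outcomeExp_truthful hπ htHat hd mech str _ (by fun_prop)
  have hgain : ∀ i, Measurable fun z => ENNReal.ofReal (u i z) := fun i => by fun_prop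
  have hloss : ∀ i, Measurable fun z => ENNReal.ofReal (-u i z) := fun i => by fun_prop
  refine ⟨directMechanism hπ htHat mech str, fun i => truthful (Θ i) (T i), fun _ => rfl,
    fun i => ⟨fun _ => rfl, fun _ _ => rfl⟩, fun i t => ?_, fun θ B hB => ?_⟩
  · obtain ⟨h1, h2, h3⟩ := h.1 i t
    simp only [interimUtility, interimGain, interimLoss] at h1 h2 h3 ⊢
    rw [htrue i t (hgain i), htrue i t (hloss i)]
    refine ⟨h1, h2, fun st => ?_⟩
    rw [interimExp_update_truthful μ hπ htHat hd mech str i st t (hgain i),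
      interimExp_update_truthful μ hπ htHat hd mech str i st t (hloss i)]
    exact lintegral_sub_lintegral_le _ h2 fun x => h3 _
  · rw [outcomeExp_truthful hπ htHat hd mech str θ (measurable_const.indicator hB)]
    exact h.2 θ B hB

end Sufficiency

/-! ### Most discerning testing functions are necessary -/

section Necessity

open MeasurableSpace

theorem scoreLaw_true_le {p q : I} : scoreLaw p true ≤ scoreLaw q true ↔ p ≤ q := by
  rw [scoreLaw_true, scoreLaw_true, ENNReal.ofReal_le_ofReal_iff q.2.1, Subtype.coe_le_coe]

/-- The score of an agent whose score is deterministic, as a probability of a pass. -/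
def sureScore (b : Bool) : I := if b then 1 else 0

theorem mix_sureScore (p : I) : mix p sureScore = p := by
  ext; simp [coe_mix, sureScore]

variable {n : ℕ}

theorem scoreProb_update (c : Fin n → I) (i : Fin n) (p : I) (s : Fin n → Bool) :
    scoreProb (Function.update c i p) s =
      scoreLaw p (s i) * ∏ j ∈ Finset.univ.erase i, scoreLaw (c j) (s j) := by
  rw [scoreProb, ← Finset.mul_prod_erase _ _ (Finset.mem_univ i), Function.update_self]
  congr 1
  refine Finset.prod_congr rfl fun j hj => ?_
  rw [Function.update_of_ne (Finset.ne_of_mem_erase hj)]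

/-- Conditioning on the score of agent `i` makes outcomes affine in his pass probability. -/
theorem scoreProb_update_eq_sum (c : Fin n → I) (i : Fin n) (p : I) (s : Fin n → Bool) :
    scoreProb (Function.update c i p) s =
      ∑ b, scoreLaw p b * scoreProb (Function.update c i (sureScore b)) s := by
  simp only [scoreProb_update, ← mul_assoc, ← Finset.sum_mul]
  rw [sum_scoreLaw_mul, mix_sureScore]

theorem sum_scoreProb_mul_apply (c : Fin n → I) (i : Fin n) (h : Bool → ℝ≥0∞) :
    ∑ s, scoreProb c s * h (s i) = ∑ b, scoreLaw (c i) b * h b := by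
  have h1 : ∀ s : Fin n → Bool, scoreProb c s * h (s i) =
      ∏ j, scoreLaw (c j) (s j) * if j = i then h (s j) else 1 := by
    intro s
    rw [Finset.prod_mul_distrib, Fintype.prod_ite_eq' i fun j => h (s j), scoreProb]
  simp only [h1]
  rw [← Fintype.prod_sum fun j b => scoreLaw (c j) b * if j = i then h b else 1]
  rw [Fintype.prod_eq_single i fun j hj => by simp only [if_neg hj, mul_one, sum_scoreLaw]]
  simp

/-! ### The environment in which one agent competes for a prize. -/

variable {Θ : Fin n → Type a} {T : Fin n → Type b}

/-- The decision set of the environment in which one agent wins or loses. -/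
abbrev Prize := ULift.{c} Bool

/-- Agent `i` wants to win; the others are indifferent. -/
noncomputable def prizeUtility (i j : Fin n) (z : Prize.{c} × (∀ i, Θ i)) : ℝ :=
  if j = i ∧ z.1.down = true then 1 else 0

theorem ofReal_prizeUtility (i : Fin n) (z : Prize.{c} × (∀ i, Θ i)) :
    ENNReal.ofReal (prizeUtility i i z) = if z.1.down = true then 1 else 0 := by
  simp only [prizeUtility, true_and]
  split_ifs <;> simp

theorem ofReal_neg_prizeUtility (i j : Fin n) (z : Prize.{c} × (∀ i, Θ i)) :
    ENNReal.ofReal (-prizeUtility i j z) = 0 := by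
  simp only [prizeUtility]
  split_ifs <;> simp

variable [∀ i, MeasurableSpace (Θ i)] [∀ i, MeasurableSpace (T i)]

theorem measurable_prizeUtility (i j : Fin n) :
    Measurable (prizeUtility.{a, c} (Θ := Θ) i j) := by
  have : Measurable fun x : Prize.{c} => if j = i ∧ x.down = true then (1 : ℝ) else 0 :=
    measurable_of_countable _
  exact this.comp measurable_fst

/-- The mechanism without messages that runs the tests `τ`, and in which agent `i` wins if he
passes. -/
noncomputable def prizeMechanism (i : Fin n) (τ : ∀ i, T i) :
    Mechanism (fun _ : Fin n => PUnit.{d + 1}) T Prize.{c} where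
  test := Transition.mk (fun _ => Measure.dirac τ) measurable_const fun _ => inferInstance
  decision := Transition.mk (fun y => Measure.dirac ⟨y.2.2 i⟩)
    (measurable_universalCompletion (Measure.measurable_dirac.comp
      ((measurable_of_countable (fun b : Bool => (⟨b⟩ : Prize.{c}))).comp (by fun_prop))))
    fun _ => inferInstance

/-- The strategy without messages that always exerts effort. -/
noncomputable def diligent (Θ T : Type*) [MeasurableSpace Θ] [MeasurableSpace T] :
    Strategy Θ PUnit.{d + 1} T where
  report := Transition.mk (fun _ => Measure.dirac PUnit.unit) measurable_const
    fun _ => inferInstance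
  effort _ := 1
  measurable_effort := measurable_const

theorem outcomeExp_prizeMechanism [∀ i, StandardBorelSpace (T i)] (π : ∀ i, T i × Θ i → I)
    (i : Fin n) (τ : ∀ i, T i)
    (str : ∀ i, Strategy (Θ i) PUnit.{d + 1} (T i)) (θ : ∀ i, Θ i) (φ : Prize.{c} → ℝ≥0∞) :
    outcomeExp π (prizeMechanism i τ) str θ φ =
      ∑ b, scoreLaw ((str i).effort (θ i, PUnit.unit, τ i) * π i (τ i, θ i)) b * φ ⟨b⟩ := by
  simp only [outcomeExp, prizeMechanism, Transition.mk_apply, lintegral_dirac]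
  have h := fun m : Fin n → PUnit.{d + 1} => sum_scoreProb_mul_apply
    (fun j => (str j).effort (θ j, m j, τ j) * π j (τ j, θ j)) i fun b => φ ⟨b⟩
  simp only [scoreProb] at h
  simp only [h]
  have hm : ∀ m : Fin n → PUnit.{d + 1}, m i = PUnit.unit := fun _ => rfl
  simp only [hm, lintegral_const, measure_univ, mul_one]

/-- The social choice function of `prizeMechanism`. -/
noncomputable def prizeFunction {π : ∀ i, T i × Θ i → I} (hπ : ∀ i, Measurable (π i)) (i : Fin n)
    (ψ : T i) : Transition (∀ i, Θ i) Prize.{c} :=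
  Transition.mk (fun θ => ∑ b, scoreLaw (π i (ψ, θ i)) b • Measure.dirac ⟨b⟩)
    (universal_sum_smul (fun b => measurable_universalCompletion
      ((measurable_scoreLaw b).comp ((hπ i).comp (by fun_prop)))) fun _ => measurable_const)
    fun θ => ⟨by simpa using sum_scoreLaw (π i (ψ, θ i))⟩

/-- Without messages a deviation can only change effort. Less effort lowers the win probability of
agent `i`, and the other agents are indifferent, so their tests are arbitrary. -/
theorem implementable_prizeFunction [∀ i, StandardBorelSpace (T i)] (μ : ∀ i, Measure (Θ i))
    [∀ i, IsProbabilityMeasure (μ i)] {π : ∀ i, T i × Θ i → I} (hπ : ∀ i, Measurable (π i))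
    (i : Fin n) (τ : ∀ i, T i) :
    Implementable.{a, b, c, d} μ π (prizeUtility i) (prizeFunction.{a, b, c} hπ i (τ i)) := by
  refine ⟨fun _ => PUnit.{d + 1}, fun _ => (inferInstance : TopologicalSpace PUnit.{d + 1}),
    fun _ => (inferInstance : PolishSpace PUnit.{d + 1}),
    fun _ => (inferInstance : MeasurableSpace PUnit.{d + 1}),
    fun _ => (inferInstance : BorelSpace PUnit.{d + 1}),
    prizeMechanism i τ, fun j => diligent (Θ j) (T j), fun j t => ?_, fun θ B hB => ?_⟩
  · have hloss : ∀ str : ∀ i, Strategy (Θ i) PUnit.{d + 1} (T i),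
        interimLoss μ π (prizeMechanism i τ) str j t (prizeUtility.{a, c} i j) = 0 := by
      intro str
      simp [interimLoss, interimExp, ofReal_neg_prizeUtility, outcomeExp]
    have hgain : ∀ st : Strategy (Θ j) PUnit.{d + 1} (T j),
        interimGain μ π (prizeMechanism i τ) (Function.update (fun j => diligent (Θ j) (T j)) j st)
          j t (prizeUtility.{a, c} i j) ≤
        interimGain μ π (prizeMechanism i τ) (fun j => diligent (Θ j) (T j))
          j t (prizeUtility.{a, c} i j) := by
      intro st
      refine lintegral_mono fun θ => ?_
      simp only [outcomeExp_prizeMechanism, Fintype.sum_bool]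
      rcases eq_or_ne i j with rfl | hj
      · simp only [ofReal_prizeUtility, Function.update_self, diligent, one_mul]
        simpa using scoreLaw_true_le.2 unitInterval.mul_le_right
      · simp [prizeUtility, hj.symm]
    refine ⟨?_, by simp [hloss], fun st => ?_⟩
    · refine ne_top_of_le_ne_top ENNReal.one_ne_top ?_
      rw [← measure_univ (μ := Measure.pi μ), ← lintegral_one]
      refine lintegral_mono fun θ => ?_
      rw [outcomeExp_prizeMechanism, ← sum_scoreLaw
        ((diligent.{d, a, b} (Θ i) (T i)).effort (Function.update θ j t i, PUnit.unit, τ i) *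
          π i (τ i, Function.update θ j t i))]
      refine Finset.sum_le_sum fun b _ => mul_le_of_le_one_right' ?_
      rw [← ENNReal.ofReal_one]
      refine ENNReal.ofReal_le_ofReal ?_
      simp only [prizeUtility]
      split_ifs <;> simp
    · simp only [interimUtility, hloss]
      simpa using hgain st
  · rw [outcomeExp_prizeMechanism]
    simp [prizeFunction, diligent, hB]
    rfl

/-! ### Reading a conversion off a canonical implementation. -/

section Converse

variable {X : Type*} [MeasurableSpace X]

/-- The expectation of `φ` of the decision in a direct mechanism with the testing function `tHat`
if agent `i` reports `r` and surely has the score `b`, and the other agents have the types `θ` and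
play canonically. -/
noncomputable def sureExp (π : ∀ i, T i × Θ i → I) (tHat : ∀ i, Θ i → T i)
    (mech : Mechanism Θ T X) (φ : X → ℝ≥0∞) (i : Fin n) (r : Θ i) (b : Bool) (θ : ∀ i, Θ i) :
    ℝ≥0∞ :=
  ∑ s, scoreProb (Function.update (fun j => π j (tHat j (θ j), θ j)) i (sureScore b)) s *
    ∫⁻ x, φ x ∂mech.decision.1
      (Function.update θ i r, fun j => tHat j (Function.update θ i r j), s)

variable {π : ∀ i, T i × Θ i → I} {tHat : ∀ i, Θ i → T i} {mech : Mechanism Θ T X}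
  {str : ∀ i, Strategy (Θ i) (Θ i) (T i)}

theorem sureExp_le_one {φ : X → ℝ≥0∞} (hφ : ∀ x, φ x ≤ 1) (i : Fin n) (r : Θ i) (b : Bool)
    (θ : ∀ i, Θ i) : sureExp π tHat mech φ i r b θ ≤ 1 := by
  rw [← sum_scoreProb (Function.update (fun j => π j (tHat j (θ j), θ j)) i (sureScore b))]
  refine Finset.sum_le_sum fun s _ => mul_le_of_le_one_right' ?_
  exact (lintegral_mono hφ).trans (by simp)

variable [∀ i, StandardBorelSpace (Θ i)] [∀ i, StandardBorelSpace (T i)]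

/-- The true type and the effort of agent `i` enter only through his pass probability: `sureExp`
depends on the report and not on `t` or `e`. -/
theorem outcomeExp_update_canonical
    (htest : ∀ θ, mech.test.1 θ = Measure.dirac fun i => tHat i (θ i)) (hcan : IsCanonical str)
    (i : Fin n) (st : Strategy (Θ i) (Θ i) (T i)) (t r : Θ i) (e : I)
    (hr : st.report.1 t = Measure.dirac r) (he : st.effort (t, r, tHat i r) = e)
    (θ : ∀ i, Θ i) (φ : X → ℝ≥0∞) :
    outcomeExp π mech (Function.update str i st) (Function.update θ i t) φ =
      ∑ b, scoreLaw (e * π i (tHat i r, t)) b * sureExp π tHat mech φ i r b θ := by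
  have hrep : (fun j => (Function.update str i st j).report.1 (Function.update θ i t j)) =
      fun j => Measure.dirac (Function.update θ i r j) := by
    ext1 j
    rcases eq_or_ne j i with rfl | hj
    · simpa using hr
    · simpa [hj] using (hcan j).1 (θ j)
  have hprob : (fun j => (Function.update str i st j).effort (Function.update θ i t j,
      Function.update θ i r j, tHat j (Function.update θ i r j)) *
        π j (tHat j (Function.update θ i r j), Function.update θ i t j)) =
      Function.update (fun j => π j (tHat j (θ j), θ j)) i (e * π i (tHat i r, t)) := by
    ext1 j
    rcases eq_or_ne j i with rfl | hj
    · simp [he]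
    · simp [hj, (hcan j).2]
  simp only [outcomeExp, htest, lintegral_dirac]
  rw [hrep, pi_dirac, lintegral_dirac]
  have hs : ∀ s : Fin n → Bool, _ := fun s => congrArg (fun c => scoreProb c s) hprob
  simp only [scoreProb] at hs
  simp only [hs, sureExp, Finset.mul_sum]
  rw [Finset.sum_comm]
  refine Finset.sum_congr rfl fun s _ => ?_
  have h := scoreProb_update_eq_sum (fun j => π j (tHat j (θ j), θ j)) i (e * π i (tHat i r, t)) s
  simp only [scoreProb] at h ⊢
  rw [h]
  simp only [Finset.sum_mul, mul_assoc]

theorem universal_sureExp (hπ : ∀ i, Measurable (π i))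
    (htHat : ∀ i, Measurable[universalCompletion (Θ i)] (tHat i)) {φ : X → ℝ≥0∞}
    (hφ : Measurable φ) (i : Fin n) (r : Θ i) (b : Bool) :
    Measurable[universalCompletion (∀ i, Θ i)] (sureExp π tHat mech φ i r b) := by
  have h1 : ∀ j, Measurable[universalCompletion (∀ i, Θ i)] fun θ : ∀ i, Θ i => θ j := fun j =>
    measurable_universalCompletion (measurable_pi_apply j)
  have h2 : Measurable[universalCompletion (∀ i, Θ i)]
      fun θ : ∀ i, Θ i => Function.update θ i r :=
    measurable_universalCompletion measurable_update_left
  refine Finset.measurable_fun_sum _ fun s _ => Measurable.mul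
    (universal_scoreProb (fun j => ?_) s) ((Measure.measurable_lintegral hφ).comp
      (universal_comp mech.decision.universal
        (h2.prodMk ((universal_comp (universal_tHat htHat) h2).prodMk measurable_const))))
  rcases eq_or_ne j i with rfl | hj
  · simp only [Function.update_self]
    exact measurable_const
  · simp only [Function.update_of_ne hj]
    exact (hπ j).comp ((universal_comp (htHat j) (h1 j)).prodMk (h1 j))

theorem interimExp_update_canonical (μ : ∀ i, Measure (Θ i)) [∀ i, IsProbabilityMeasure (μ i)]
    (hπ : ∀ i, Measurable (π i)) (htHat : ∀ i, Measurable[universalCompletion (Θ i)] (tHat i))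
    (htest : ∀ θ, mech.test.1 θ = Measure.dirac fun i => tHat i (θ i)) (hcan : IsCanonical str)
    (i : Fin n) (st : Strategy (Θ i) (Θ i) (T i)) (t r : Θ i) (e : I)
    (hr : st.report.1 t = Measure.dirac r) (he : st.effort (t, r, tHat i r) = e)
    {φ : X → ℝ≥0∞} (hφ : Measurable φ) :
    interimExp μ π mech (Function.update str i st) i t (fun z => φ z.1) =
      ∑ b, scoreLaw (e * π i (tHat i r, t)) b *
        ∫⁻ θ, sureExp π tHat mech φ i r b θ ∂Measure.pi μ := by
  have hm := fun b => aemeasurable_of_universal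
    (universal_sureExp (mech := mech) hπ htHat hφ i r b) (Measure.pi μ)
  simp only [interimExp, outcomeExp_update_canonical htest hcan i st t r e hr he]
  rw [lintegral_finsetSum' _ fun b _ => (hm b).const_mul _]
  exact Finset.sum_congr rfl fun b _ => lintegral_const_mul'' _ (hm b)

/-- If the social choice function that rewards a pass of agent `i` on the test `ψ` is canonically
implementable with `tHat`, then `tHat i t` is more `t`-discerning than `ψ`. -/
theorem moreDiscerning_of_canonicallyImplementableWith (μ : ∀ i, Measure (Θ i))
    [∀ i, IsProbabilityMeasure (μ i)] (hπ : ∀ i, Measurable (π i))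
    (htHat : ∀ i, Measurable[universalCompletion (Θ i)] (tHat i)) (i : Fin n) (t : Θ i) (ψ : T i)
    (h : CanonicallyImplementableWith μ π (prizeUtility.{a, c} i) (fun θ i => tHat i (θ i))
      (prizeFunction hπ i ψ)) :
    MoreDiscerning (π i) t (tHat i t) ψ := by
  obtain ⟨mech, str, htest, hcan, hBN, hind⟩ := h
  set φ : Prize.{c} → ℝ≥0∞ := fun x => if x.down = true then 1 else 0 with hφ
  have hφm : Measurable φ := measurable_of_countable _
  have hgain : ∀ (str : ∀ i, Strategy (Θ i) (Θ i) (T i)) (t : Θ i),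
      interimGain μ π mech str i t (prizeUtility i i) =
        interimExp μ π mech str i t fun z => φ z.1 := by
    intro str t
    simp only [interimGain, ofReal_prizeUtility, hφ]
  have hloss : ∀ (str : ∀ i, Strategy (Θ i) (Θ i) (T i)) (t : Θ i),
      interimLoss μ π mech str i t (prizeUtility i i) = 0 := by
    intro str t
    simp [interimLoss, interimExp, ofReal_neg_prizeUtility, outcomeExp]
  have htrue : ∀ t', interimExp μ π mech str i t' (fun z => φ z.1) =
      scoreLaw (π i (ψ, t')) true := by
    intro t'
    have hB : MeasurableSet {x : Prize.{c} | x.down = true} := MeasurableSet.of_discrete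
    have h1 : φ = Set.indicator {x : Prize.{c} | x.down = true} fun _ => 1 := by
      ext x; simp [hφ, Set.indicator_apply]
    have h2 : ∀ θ, outcomeExp π mech str (Function.update θ i t') φ =
        scoreLaw (π i (ψ, t')) true := by
      intro θ
      rw [h1, ← hind _ _ hB]
      simp [prizeFunction]
    simp [interimExp, h2]
  have hle : ∀ b, ∫⁻ θ, sureExp π tHat mech φ i t b θ ∂Measure.pi μ ≤ 1 := fun b =>
    (lintegral_mono fun θ => sureExp_le_one (fun x => by simp only [hφ]; split_ifs <;> simp)
      i t b θ).trans (by simp)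
  -- The candidate conversion: the interim probability of winning after the report `t` and the sure
  -- score `b`, the same for every true type.
  let c : Bool → I := fun b => ⟨(∫⁻ θ, sureExp π tHat mech φ i t b θ ∂Measure.pi μ).toReal,
    ENNReal.toReal_nonneg, ENNReal.toReal_le_of_le_ofReal zero_le_one (by simpa using hle b)⟩
  have hc : ∀ b, ∫⁻ θ, sureExp π tHat mech φ i t b θ ∂Measure.pi μ = scoreLaw (c b) true := by
    intro b
    rw [scoreLaw_true, ENNReal.ofReal_toReal (ne_top_of_le_ne_top ENNReal.one_ne_top (hle b))]
  -- Equilibrium play of type `t` is treated as the trivial deviation to his own strategy.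
  have heq : mix (π i (tHat i t, t)) c = π i (ψ, t) := by
    have h1 := interimExp_update_canonical μ hπ htHat htest hcan i (str i) t t 1
      ((hcan i).1 t) ((hcan i).2 t _) hφm
    rw [Function.update_eq_self, htrue, one_mul] at h1
    simp only [hc, sum_scoreLaw_mul] at h1
    exact (le_antisymm (scoreLaw_true_le.1 h1.le) (scoreLaw_true_le.1 h1.ge)).symm
  -- Type `t'` may report `t` and exert constant effort `e`. Full effort gives the discernment
  -- inequalities, zero effort the bound used when `c` is decreasing.
  have hdev : ∀ t' e, mix (e * π i (tHat i t, t')) c ≤ π i (ψ, t') := by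
    intro t' e
    let st : Strategy (Θ i) (Θ i) (T i) :=
      { report := Transition.mk (fun _ => Measure.dirac t) measurable_const fun _ => inferInstance
        effort := fun _ => e
        measurable_effort := measurable_const }
    have h1 := interimExp_update_canonical μ hπ htHat htest hcan i st t' t e rfl rfl hφm
    simp only [hc, sum_scoreLaw_mul] at h1
    have h2 := (hBN i t').2.2 st
    simp only [interimUtility, hloss, hgain, h1, htrue] at h2
    exact scoreLaw_true_le.1 (by simpa using h2)
  rw [moreDiscerning_iff]
  -- If failing paid more than passing, then zero effort after the report `t` would secure `c false`
  -- for every type. So `c false` bounds all rates on `ψ` from below, and it equals the rate of `t`,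
  -- which averages `c false` with something smaller. The constant conversion then works.
  by_cases hmono : c false ≤ c true
  · exact ⟨c, hmono, heq, fun θ' _ => by simpa using hdev θ' 1⟩
  · have h0 : ∀ p, mix p (fun _ => c false) = c false := fun p => by
      ext; rw [coe_mix]; ring
    have h1 : ∀ t', c false ≤ π i (ψ, t') := fun t' => by
      have := hdev t' 0
      rw [zero_mul] at this
      refine le_trans (le_of_eq ?_) this
      ext; simp [coe_mix]
    refine ⟨fun _ => c false, le_rfl, ?_, fun θ' _ => by rw [h0]; exact h1 θ'⟩
    rw [h0]
    refine le_antisymm (h1 t) ?_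
    rw [← heq, ← Subtype.coe_le_coe, coe_mix]
    have h2 : (c true : ℝ) < c false := not_le.1 hmono
    nlinarith [(π i (tHat i t, t)).2.1]

end Converse

end Necessity

end TestDesign

/-! ### The equivalence. -/

theorem mainTheorem10 {n : ℕ} (Θ : Fin n → Type a) (T : Fin n → Type b)
    [∀ i, TopologicalSpace (Θ i)] [∀ i, PolishSpace (Θ i)]
    [∀ i, MeasurableSpace (Θ i)] [∀ i, BorelSpace (Θ i)]
    [∀ i, TopologicalSpace (T i)] [∀ i, PolishSpace (T i)]
    [∀ i, MeasurableSpace (T i)] [∀ i, BorelSpace (T i)]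
    (μ : ∀ i, Measure (Θ i)) [∀ i, IsProbabilityMeasure (μ i)]
    (π : ∀ i, T i × Θ i → I) (hπ : ∀ i, Measurable (π i))
    (tHat : ∀ i, Θ i → T i)
    (htHat : ∀ i, Measurable[TestDesign.universalCompletion (Θ i)] (tHat i)) :
    (∀ i, TestDesign.MostDiscerning (π i) (tHat i)) ↔
      ∀ (X : Type c) [TopologicalSpace X] [PolishSpace X] [MeasurableSpace X] [BorelSpace X]
        (u : Fin n → X × (∀ i, Θ i) → ℝ), (∀ i, Measurable (u i)) →
        ∀ f : TestDesign.Transition (∀ i, Θ i) X,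
          TestDesign.Implementable.{a, b, c, d} μ π u f →
            TestDesign.CanonicallyImplementableWith μ π u
              (fun (θ : ∀ i, Θ i) (i : Fin n) => tHat i (θ i)) f := by
  constructor
  · intro hd X _ _ _ _ u hu f hf
    obtain ⟨M, _, _, _, _, mech, str, h⟩ := hf
    exact TestDesign.canonicallyImplementableWith_of_implements μ hπ htHat hd hu h
  · intro h i t ψ
    refine TestDesign.moreDiscerning_of_canonicallyImplementableWith.{a, b, c} μ hπ htHat i t ψ
      (h _ _ (TestDesign.measurable_prizeUtility i) _ ?_)
    -- The prize mechanism needs some test for every other agent. The priors make the type spaces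
    -- nonempty, and `tHat` then supplies one.
    have θ : ∀ j, Θ j := fun j => (μ j).nonempty_of_neZero.some
    have h1 := TestDesign.implementable_prizeFunction.{a, b, c, d} μ hπ i
      (Function.update (fun j => tHat j (θ j)) i ψ)
    rwa [Function.update_self] at h1
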